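/- Let $n\ge 0$ be an integer and let $N(1),\dots,N(n)$ be independent, identically distributed, centred jointly Gaussian random vectors $N(j)=(N(j)_1,N(j)_2,N(j)_3)$ in $\mathbb R^3$. For $i\in\{1,2,3\}$ put $\mathcal N_i=(N(1)_i,\dots,N(n)_i)\in\mathbb R^n$; indices $i$ are read cyclically modulo $3$. For measurable $f_1,f_2,f_3:\mathbb R^n\to[-1,1]$ write $\mathbf E[f_i]=\mathbf E[f_i(\mathcal N_i)]$ and $$P(f_1,f_2,f_3)=\mathbf E\big[s(f_1(\mathcal N_1),f_2(\mathcal N_2),f_3(\mathcal N_3))\big],\qquad s(x,y,z)=\tfrac14(1+xy+yz+zx),$$ where $s$ restricted to $\{-1,1\}^3$ is the indicator of $x=y=z$. Call the setup *uniform* if $\mathbf E[N(j)_k^2]=1$ and $\mathbf E[N(j)_kN(j)_l]=-1/3$ for all $j$ and all $k\ne l$. Let $\varepsilon>0$. 1. (Gaussian Arrow theorem.) In the uniform setup, let $f_1,f_2,f_3:\mathbb R^n\to\{-1,1\}$ be measurable and suppose that for all $1\le i\le 3$ and $u\in\{-1,1\}$ $$\mathbf P[f_i(\mathcal N_i)=u,\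 f_{i+1}(\mathcal N_{i+1})=-u]\le 1-\varepsilon .$$ Then $\mathbf P[f_1(\mathcal N_1)=f_2(\mathcal N_2)=f_3(\mathcal N_3)]\ge(\varepsilon/2)^{18}$. 2. ($[-1,1]$-valued version.) In the uniform setup, let $f_1,f_2,f_3:\mathbb R^n\to[-1,1]$ be measurable and suppose that for all $1\le i\le 3$ and $u\in\{-1,1\}$ $$\min\big(u\,\mathbf E[f_i],\,-u\,\mathbf E[f_{i+1}]\big)\le 1-2\varepsilon .$$ Then $P(f_1,f_2,f_3)\ge(\varepsilon/2)^{20}$. 3. ($[-1,1]$-valued version, symmetric distributions.) Let $\mu$ be a probability distribution on the $6$ rankings of three alternatives $a,b,c$ that gives every ranking the same probability as its reversal, and suppose that its minimal atom probability $\alpha=\min_\sigma\mu(\sigma)$ is positive. For $\sigma\sim\mu$ let $x_1,x_2,x_3\in\{-1,1\}$ equal $1$ exactly when $\sigma$ ranks $a$ above $b$, $b$ above $c$, $c$ above $a$, respectively. If $\mathbf E[N(j)_kN(j)_l]=\mathbf E[x_kx_l]$ for all $j$ and all $k,l\in\{1,2,3\}$, then for all $f_1,f_2,f_3$ as in 2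 (with the same hypothesis) $$P(f_1,f_2,f_3)\ge(\varepsilon/2)^{2+1/(2\alpha^2)} .$$ -/

import Mathlib

open MeasureTheory ProbabilityTheory

noncomputable section

namespace GaussArrow

/-- `N 0, …, N (n-1)` are independent, centred, jointly Gaussian vectors in `ℝ³`, each with
covariances `E[N_a N_b] = C a b`. -/
structure IsGaussianSample {Ω : Type*} [MeasurableSpace Ω] (P : Measure Ω) {n : ℕ}
    (C : Fin 3 → Fin 3 → ℝ) (N : Fin n → Ω → Fin 3 → ℝ) : Prop where
  gaussian : ∀ j, HasGaussianLaw (N j) P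
  mean : ∀ j a, ∫ ω, N j ω a ∂P = 0
  cov : ∀ j a b, ∫ ω, N j ω a * N j ω b ∂P = C a b
  indep : iIndepFun N P

/-- The vector `𝒩_i = (N(1)_i, …, N(n)_i)` of all the `i`-th coordinates. -/
def coordVec {Ω : Type*} {n : ℕ} (N : Fin n → Ω → Fin 3 → ℝ) (i : Fin 3) (ω : Ω) : Fin n → ℝ :=
  fun j => N j ω i

/-- Unit variances, all pairwise correlations `-1/3`. -/
def uniformCov (a b : Fin 3) : ℝ := if a = b then 1 else -1 / 3

/-- The multi-affine function `s` which on `{-1,1}³` is the indicator of `x = y = z`. -/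
def s (x y z : ℝ) : ℝ := 1 / 4 * (1 + x * y + y * z + z * x)

/-- `P(f₁,f₂,f₃) = E[s(f₁(𝒩₁), f₂(𝒩₂), f₃(𝒩₃))]`. -/
def paradox {Ω : Type*} [MeasurableSpace Ω] (P : Measure Ω) {n : ℕ}
    (N : Fin n → Ω → Fin 3 → ℝ) (f : Fin 3 → (Fin n → ℝ) → ℝ) : ℝ :=
  ∫ ω, s (f 0 (coordVec N 0 ω)) (f 1 (coordVec N 1 ω)) (f 2 (coordVec N 2 ω)) ∂P

/-- A ranking of the alternatives `0, 1, 2`: `σ a` is the rank of `a`, rank `0` being the top.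
`pref i σ` is `1` if `σ` ranks `i` above `i + 1` (cyclically) and `-1` otherwise, so the three
values are `x^{a>b}`, `x^{b>c}`, `x^{c>a}`. -/
def pref (i : Fin 3) (σ : Equiv.Perm (Fin 3)) : ℝ := if σ i < σ (i + 1) then 1 else -1

/-- The reversed ranking `-σ`. -/
def reverse (σ : Equiv.Perm (Fin 3)) : Equiv.Perm (Fin 3) := σ.trans Fin.revPerm

/-- A voting distribution is symmetric if it gives `σ` and `-σ` the same probability. -/
def IsSymmetric (μ : PMF (Equiv.Perm (Fin 3))) : Prop := ∀ σ, μ (reverse σ) = μ σ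

/-- The minimal atom probability `α(μ) = min_σ μ(σ)`. -/
def minAtom (μ : PMF (Equiv.Perm (Fin 3))) : ℝ := ⨅ σ, (μ σ).toReal

/-- The covariances `E[x_i x_j]` of the pairwise preferences of one voter with law `μ`. -/
def voteCov (μ : PMF (Equiv.Perm (Fin 3))) (i j : Fin 3) : ℝ :=
  ∑ σ, (μ σ).toReal * (pref i σ * pref j σ)

end GaussArrow

end

/-!
The three bounds come from one inequality. Let the covariance matrix `C` of a single vector `N j`
have unit diagonal and satisfy `C ≥ r I` for some `r > 0`. Then for `[0,1]`-valued `g₀, g₁, g₂`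
`∏ (E g_i) ^ (1 / r) ≤ E ∏ g_i(𝒩_i)` (`prod_rpow_le`).

*From this to the theorem.* The function `s` is the sum over `u = ±1` of `∏ (1 + u x_i) / 2`, so
the paradox probability is at least `E ∏ g_i(𝒩_i)` with `g_i = (1 + u f_i) / 2`, for either sign
`u`. The hypothesis says that no two of the functions are close to opposite constants; hence for one
of the signs all three means `E g_i` are at least `ε / 2` (`exists_common_sign`), and the paradox
probability is at least `(ε / 2) ^ (3 / r)` (`rpow_le_paradox`). In the uniform setup `r = 1 / 3`,
which gives the exponent `9`; for a voting distribution with minimal atom `α` one may take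
`r = 2 α` (`voteCov_coercive`), and `3 / (2 α) ≤ 2 + 1 / (2 α ^ 2)`.

*The inequality.* Factor `C - r I = A Aᵀ`. Then `𝒩` has the law of `√r Z + A ξ` with `Z`, `ξ`
independent and standard. Conditionally on `ξ` the three factors are independent, so
`E ∏ g_i(𝒩_i) = E ∏ h_i((A ξ)_i)` where `h_i(y) = E g_i(y + √r Z_i)`, and by Jensen's inequality
this is at least `exp (∑ E log h_i((A ξ)_i))`, whatever the dependence between the three vectors
`(A ξ)_i`. Each of them is `a` times a standard Gaussian vector, `a ^ 2 = 1 - r`, which leaves a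
statement about one function (`reverse_hyp`): Borell's reverse hypercontractivity at the exponent zero,
`1 / b² * log E g ^ b² ≤ E_y log E_z g(a y + b z)` whenever `a² + b² = 1`.

*Reverse hypercontractivity.* It tensorizes, because geometric means are superadditive
(`log_integral_exp_le`). On the line, let `T` be the increasing map that transports the Gaussian
measure to the probability measure proportional to `g ^ b²` times it. Substitute `x = T w` in
`E_z g(a y + b z)` and apply Jensen's inequality to the logarithm. After averaging over `y`, what
remains is `E log T' ≤ E w (T w - w)`, which is Gaussian integration by parts together with
`log T' ≤ T' - 1`. To avoid all tail estimates, the transport is done between the restrictions to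
`[-R, R]`, with `g` replaced by a constant outside (`reverse_hyp_frozen`), and then `R → ∞`.
-/

namespace GaussArrow

open scoped Topology

/-! ### Integrals of bounded functions -/

lemma integrable_of_mem_Icc {α : Type*} [MeasurableSpace α] {μ : Measure α} [IsFiniteMeasure μ]
    {f : α → ℝ} (hf : Measurable f) {c C : ℝ} (h : ∀ x, f x ∈ Set.Icc c C) : Integrable f μ :=
  Integrable.of_mem_Icc c C hf.aemeasurable (Filter.Eventually.of_forall h)

lemma integrable_of_bdd {α : Type*} [MeasurableSpace α] {μ : Measure α} [IsFiniteMeasure μ]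
    {f : α → ℝ} (hf : Measurable f) {c : ℝ} (hc : ∀ x, |f x| ≤ c) : Integrable f μ :=
  Integrable.of_bound hf.aestronglyMeasurable c (Filter.Eventually.of_forall hc)

lemma integral_mem_Icc {α : Type*} [MeasurableSpace α] {μ : Measure α} [IsProbabilityMeasure μ]
    {f : α → ℝ} (hf : Measurable f) {c C : ℝ} (h : ∀ x, f x ∈ Set.Icc c C) :
    ∫ x, f x ∂μ ∈ Set.Icc c C := by
  have hi : Integrable f μ := integrable_of_mem_Icc hf h
  constructor
  · simpa using integral_mono (integrable_const c) hi fun x => (h x).1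
  · simpa using integral_mono hi (integrable_const C) fun x => (h x).2

lemma log_mem_Icc {c C x : ℝ} (hc : 0 < c) (h : x ∈ Set.Icc c C) :
    Real.log x ∈ Set.Icc (Real.log c) (Real.log C) :=
  ⟨Real.log_le_log hc h.1, Real.log_le_log (hc.trans_le h.1) h.2⟩

lemma measurable_integral_right {α β : Type*} [MeasurableSpace α] [MeasurableSpace β]
    (ν : Measure β) [SFinite ν] {F : α → β → ℝ} (hF : Measurable fun p : α × β => F p.1 p.2) :
    Measurable fun x => ∫ y, F x y ∂ν :=
  (hF.stronglyMeasurable.integral_prod_right (f := F)).measurable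

lemma integrable_log_integral {α β : Type*} [MeasurableSpace α] [MeasurableSpace β]
    (μ : Measure α) [IsProbabilityMeasure μ] (ν : Measure β) [IsProbabilityMeasure ν]
    {F : α → β → ℝ} (hF : Measurable fun p : α × β => F p.1 p.2) {c C : ℝ} (hc : 0 < c)
    (h : ∀ x y, F x y ∈ Set.Icc c C) : Integrable (fun x => Real.log (∫ y, F x y ∂ν)) μ :=
  Integrable.of_mem_Icc (Real.log c) (Real.log C)
    (Real.measurable_log.comp (measurable_integral_right ν hF)).aemeasurable
    (Filter.Eventually.of_forall fun x => log_mem_Icc hc (integral_mem_Icc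
      (hF.comp measurable_prodMk_left) (h x)))

lemma integral_const_add_sub {α : Type*} [MeasurableSpace α] {μ : Measure α}
    [IsProbabilityMeasure μ] {f g : α → ℝ} (hf : Integrable f μ) (hg : Integrable g μ) (c s t : ℝ) :
    ∫ x, (c + s * f x - t * g x) ∂μ = c + s * ∫ x, f x ∂μ - t * ∫ x, g x ∂μ := by
  have h1 : Integrable (fun x => c + s * f x) μ := (integrable_const c).add (hf.const_mul s)
  rw [integral_sub h1 (hg.const_mul t), integral_add (integrable_const c) (hf.const_mul s),
    integral_const_mul, integral_const_mul]
  simp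

lemma exp_jensen {α : Type*} [MeasurableSpace α] {μ : Measure α} [IsProbabilityMeasure μ]
    {L : α → ℝ} (hL : Integrable L μ) (hexp : Integrable (fun x => Real.exp (L x)) μ) :
    ∫ x, L x ∂μ ≤ Real.log (∫ x, Real.exp (L x) ∂μ) := by
  have h := convexOn_exp.map_integral_le (μ := μ) (f := L) Real.continuous_exp.continuousOn
    isClosed_univ (by simp) hL hexp
  rw [Real.le_log_iff_exp_le (lt_of_lt_of_le (Real.exp_pos _) h)]
  exact h

/-! ### Monotone transport on an interval -/

/-- The increasing map of `[-R, R]` that carries the density `p` to the density `q`, when these have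
the same mass on that interval. Outside the interval `T` is of no significance. -/
lemma exists_monotone_transport {R : ℝ} (hR : 0 < R) {p q : ℝ → ℝ} (hp : Continuous p)
    (hq : Continuous q) (p0 : ∀ x, 0 < p x) (q0 : ∀ x, 0 < q x)
    (hpq : ∫ x in (-R)..R, p x = ∫ x in (-R)..R, q x) :
    ∃ T : ℝ → ℝ, StrictMono T ∧ T (-R) = -R ∧ T R = R ∧
      ∀ w ∈ Set.Icc (-R) R, HasDerivAt T (p w / q (T w)) w := by
  have hRR : -R ≤ R := by linarith
  -- Freezing a density at its endpoint values outside `[-R, R]` makes its primitive a bijection.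
  let cl : ℝ → ℝ := fun x => max (-R) (min R x)
  have hcl : Continuous cl := by fun_prop
  have clm : ∀ x, cl x ∈ Set.Icc (-R) R := fun x => ⟨le_max_left _ _, max_le hRR (min_le_left _ _)⟩
  have cle : ∀ x ∈ Set.Icc (-R) R, cl x = x := fun x hx => by
    simp only [cl, min_eq_right hx.2, max_eq_right hx.1]
  have key : ∀ p : ℝ → ℝ, Continuous p → (∀ x, 0 < p x) → ∃ B : ℝ ≃o ℝ,
      (∀ x, HasDerivAt B (p (cl x)) x) ∧ B (-R) = 0 ∧ B R = ∫ x in (-R)..R, p x := by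
    intro p hp p0
    have hc : Continuous fun x => p (cl x) := hp.comp hcl
    let F : ℝ → ℝ := fun x => ∫ t in (-R)..x, p (cl t)
    have hF : ∀ x, HasDerivAt F (p (cl x)) x := fun x =>
      intervalIntegral.integral_hasDerivAt_right (hc.intervalIntegrable _ _)
        hc.stronglyMeasurable.stronglyMeasurableAtFilter hc.continuousAt
    have hmono : StrictMono F := strictMono_of_deriv_pos fun x => by
      rw [(hF x).deriv]; exact p0 _
    obtain ⟨m, hm, hmin⟩ := (isCompact_Icc (a := -R) (b := R)).exists_isMinOn
      ⟨-R, le_refl _, hRR⟩ hp.continuousOn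
    have hlow : ∀ x y, x ≤ y → p m * (y - x) ≤ F y - F x := by
      intro x y hxy
      have : Convex ℝ (Set.univ : Set ℝ) := convex_univ
      refine this.mul_sub_le_image_sub_of_le_deriv (f := F)
        (fun x _ => (hF x).continuousAt.continuousWithinAt)
        (fun x _ => (hF x).differentiableAt.differentiableWithinAt) ?_ x trivial y trivial hxy
      intro x _
      rw [(hF x).deriv]
      exact hmin (clm x)
    have hcont : Continuous F := continuous_iff_continuousAt.2 fun x => (hF x).continuousAt
    have hsurj : Function.Surjective F := by
      refine hcont.surjective ?_ ?_
      · refine Filter.tendsto_atTop_mono' (f₁ := fun y => p m * (y - 0) + F 0) _ ?_ ?_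
        · filter_upwards [Filter.eventually_ge_atTop 0] with y hy
          linarith [hlow 0 y hy]
        · refine Filter.tendsto_atTop_add_const_right _ _ ?_
          simp only [sub_zero]
          exact Filter.Tendsto.const_mul_atTop (p0 m) Filter.tendsto_id
      · refine Filter.tendsto_atBot_mono' (f₁ := fun y => p m * (y - 0) + F 0) _ ?_ ?_
        · filter_upwards [Filter.eventually_le_atBot 0] with y hy
          linarith [hlow y 0 hy]
        · refine Filter.tendsto_atBot_add_const_right _ _ ?_
          simp only [sub_zero]
          exact Filter.Tendsto.const_mul_atBot (p0 m) Filter.tendsto_id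
    refine ⟨hmono.orderIsoOfSurjective F hsurj, hF, ?_, ?_⟩
    · simp [F]
    · change F R = _
      refine intervalIntegral.integral_congr fun x hx => ?_
      rw [Set.uIcc_of_le hRR] at hx
      simp only [cle x hx]
  obtain ⟨A, hA, A1, A2⟩ := key p hp p0
  obtain ⟨B, hB, B1, B2⟩ := key q hq q0
  refine ⟨fun w => B.symm (A w), fun x y h => B.symm.strictMono (A.strictMono h), ?_, ?_, ?_⟩
  · rw [B.symm_apply_eq, A1, B1]
  · rw [B.symm_apply_eq, A2, B2, hpq]
  · intro w hw
    have hm : B.symm (A w) ∈ Set.Icc (-R) R := by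
      constructor
      · rw [B.le_symm_apply, B1, ← A1]; exact A.monotone hw.1
      · rw [B.symm_apply_le, B2, ← hpq, ← A2]; exact A.monotone hw.2
    have h1 := hA w
    rw [cle w hw] at h1
    have h2 := hB (B.symm (A w))
    rw [cle _ hm] at h2
    have h3 : HasDerivAt (fun x => B.symm x) (q (B.symm (A w)))⁻¹ (A w) :=
      HasDerivAt.of_local_left_inverse B.symm.continuous.continuousAt h2 (q0 _).ne'
        (Filter.Eventually.of_forall fun x => B.apply_symm_apply x)
    have := h3.comp w h1
    rw [div_eq_inv_mul]
    exact this

/-! ### Gaussian integrals on the line -/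

/-- The standard Gaussian measure on the line. -/
noncomputable abbrev stdG : Measure ℝ := gaussianReal 0 1

lemma map_affine_stdG (m b : ℝ) :
    stdG.map (fun z => m + b * z) = gaussianReal m (NNReal.mk (b ^ 2) (sq_nonneg b)) := by
  have h : (fun z => m + b * z) = (fun x => m + x) ∘ (fun z => b * z) := rfl
  rw [h, ← Measure.map_map (by fun_prop) (by fun_prop), gaussianReal_map_const_mul,
    gaussianReal_map_const_add]
  simp

lemma mk_sq_ne_zero {b : ℝ} (hb : 0 < b) : NNReal.mk (b ^ 2) (sq_nonneg b) ≠ 0 := by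
  intro h
  have := congrArg NNReal.toReal h
  simp at this
  exact hb.ne' this

lemma integral_stdG_affine {b : ℝ} (hb : 0 < b) (m : ℝ) {F : ℝ → ℝ} (hF : Measurable F) :
    ∫ z, F (m + b * z) ∂stdG =
      ∫ w, gaussianPDFReal m (NNReal.mk (b ^ 2) (sq_nonneg b)) w * F w := by
  rw [← integral_map (φ := fun z => m + b * z) (by fun_prop) hF.aestronglyMeasurable,
    map_affine_stdG, integral_gaussianReal_eq_integral_smul (mk_sq_ne_zero hb)]
  simp

/-- Invariance of the Gaussian plane under the rotation `(y, z) = (a w - b v, b w + a v)`, for which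
`a y + b z = w`. -/
lemma integral_stdG_rotate {a b : ℝ} (hab : a ^ 2 + b ^ 2 = 1) (hb : 0 < b) {F : ℝ × ℝ → ℝ}
    (hF : Measurable F) :
    ∫ p, F p ∂(stdG.prod stdG) =
      ∫ p, F (a * p.1 - b * p.2, b * p.1 + a * p.2) ∂(stdG.prod stdG) := by
  have h0 : stdG[id] = 0 := by simp
  have h := IsGaussian.map_rotation_eq_self h0 (-Real.arccos a)
  have hs : Real.sin (Real.arccos a) = b := by
    rw [Real.sin_arccos, show 1 - a ^ 2 = b ^ 2 by linarith, Real.sqrt_sq hb.le]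
  have hc : Real.cos (Real.arccos a) = a := Real.cos_arccos (by nlinarith) (by nlinarith)
  conv_lhs => rw [← h]
  rw [integral_map (by fun_prop) hF.aestronglyMeasurable]
  congr 1
  ext p
  simp [ContinuousLinearMap.rotation_apply, hs, hc, sub_eq_add_neg]

lemma integrable_id_stdG : Integrable (fun x : ℝ => x) stdG :=
  (memLp_id_gaussianReal (μ := 0) (v := 1) 1).integrable (by simp)

lemma integrable_fst_mul_comp {a b : ℝ} {τ : ℝ → ℝ} (hτ : Measurable τ) {c : ℝ}
    (hc : ∀ x, |τ x| ≤ c) :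
    Integrable (fun p : ℝ × ℝ => p.1 * τ (a * p.1 + b * p.2)) (stdG.prod stdG) :=
  (integrable_id_stdG.comp_fst stdG).mul_bdd (c := c)
    (by fun_prop : Measurable _).aestronglyMeasurable
    (Filter.Eventually.of_forall fun p => hc _)

/-- The regression of `y` on `w = a y + b z` is `a w`. -/
lemma integral_fst_mul_comp {a b : ℝ} (hab : a ^ 2 + b ^ 2 = 1) (hb : 0 < b) {τ : ℝ → ℝ}
    (hτ : Measurable τ) {c : ℝ} (hc : ∀ x, |τ x| ≤ c) :
    ∫ y, ∫ z, y * τ (a * y + b * z) ∂stdG ∂stdG = a * ∫ w, w * τ w ∂stdG := by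
  rw [← integral_prod (f := fun p : ℝ × ℝ => p.1 * τ (a * p.1 + b * p.2))
    (integrable_fst_mul_comp hτ hc), integral_stdG_rotate hab hb (by fun_prop)]
  have e : ∀ p : ℝ × ℝ, a * (a * p.1 - b * p.2) + b * (b * p.1 + a * p.2) = p.1 := fun p => by
    linear_combination p.1 * hab
  simp only [e]
  have hτi : Integrable τ stdG := integrable_of_bdd hτ hc
  have hwτ : Integrable (fun w => w * τ w) stdG :=
    integrable_id_stdG.mul_bdd (c := c) hτ.aestronglyMeasurable
      (Filter.Eventually.of_forall hc)
  have e2 : ∀ p : ℝ × ℝ, (a * p.1 - b * p.2) * τ p.1 = a * (p.1 * τ p.1) - b * (τ p.1 * p.2) :=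
    fun p => by ring
  simp only [e2]
  rw [integral_sub ((hwτ.comp_fst stdG).const_mul a)
    ((hτi.mul_prod integrable_id_stdG).const_mul b), integral_const_mul, integral_const_mul,
    integral_prod_mul τ (fun x => x)]
  rw [integral_fun_fst (fun w => w * τ w)]
  simp

lemma integral_comp_rotate {a b : ℝ} (hab : a ^ 2 + b ^ 2 = 1) (hb : 0 < b) {τ : ℝ → ℝ}
    (hτ : Measurable τ) {c : ℝ} (hc : ∀ x, |τ x| ≤ c) :
    ∫ y, ∫ z, τ (a * y + b * z) ∂stdG ∂stdG = ∫ w, τ w ∂stdG := by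
  rw [← integral_prod (f := fun p : ℝ × ℝ => τ (a * p.1 + b * p.2))
    (integrable_of_bdd (by fun_prop) fun _ => hc _), integral_stdG_rotate hab hb (by fun_prop)]
  have e : ∀ p : ℝ × ℝ, a * (a * p.1 - b * p.2) + b * (b * p.1 + a * p.2) = p.1 := fun p => by
    linear_combination p.1 * hab
  simp only [e]
  rw [integral_fun_fst τ]
  simp

lemma hasDerivAt_gaussianPDFReal (w : ℝ) :
    HasDerivAt (gaussianPDFReal 0 1) (-w * gaussianPDFReal 0 1 w) w := by
  have h : HasDerivAt (fun x : ℝ => (Real.sqrt (2 * Real.pi))⁻¹ * Real.exp (-x ^ 2 / 2))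
      ((Real.sqrt (2 * Real.pi))⁻¹ * (Real.exp (-w ^ 2 / 2) * (-(2 * w) / 2))) w := by
    have h1 : HasDerivAt (fun x : ℝ => -x ^ 2 / 2) (-(2 * w) / 2) w := by
      simpa using ((hasDerivAt_pow 2 w).neg.div_const 2)
    exact (h1.exp).const_mul _
  have e : gaussianPDFReal 0 1 =
      fun x : ℝ => (Real.sqrt (2 * Real.pi))⁻¹ * Real.exp (-x ^ 2 / 2) := by
    ext x; simp [gaussianPDFReal]
  rw [e]
  convert h using 1
  ring

lemma continuous_gaussianPDFReal : Continuous (gaussianPDFReal 0 1) :=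
  continuous_iff_continuousAt.2 fun w => (hasDerivAt_gaussianPDFReal w).continuousAt

lemma gaussianPDFReal_std_pos (x : ℝ) : 0 < gaussianPDFReal 0 1 x :=
  gaussianPDFReal_pos 0 1 x one_ne_zero

lemma integral_indicator_stdG {s : Set ℝ} (hs : MeasurableSet s) (f : ℝ → ℝ) :
    ∫ x, s.indicator f x ∂stdG = ∫ x in s, gaussianPDFReal 0 1 x * f x := by
  rw [integral_gaussianReal_eq_integral_smul one_ne_zero, ← integral_indicator hs]
  congr 1
  ext x
  by_cases h : x ∈ s <;> simp [h]

/-- Gaussian integration by parts on `[-R, R]` for `T w - w`. There are no boundary terms, since `T`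
fixes the endpoints. -/
lemma gaussian_stein_transport {R : ℝ} (hR : 0 < R) {T D : ℝ → ℝ} (TL : T (-R) = -R) (TR : T R = R)
    (hT : ∀ w ∈ Set.Icc (-R) R, HasDerivAt T (D w) w) (hD : ContinuousOn D (Set.Icc (-R) R)) :
    ∫ w, (Set.Ioo (-R) R).indicator (fun w => w * (T w - w)) w ∂stdG =
      ∫ w, (Set.Ioo (-R) R).indicator (fun w => D w - 1) w ∂stdG := by
  have hRR : -R ≤ R := by linarith
  have hTc : ContinuousOn T (Set.Icc (-R) R) := fun w hw =>
    (hT w hw).continuousAt.continuousWithinAt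
  have hφ := continuous_gaussianPDFReal.continuousOn (s := Set.Icc (-R) R)
  rw [integral_indicator_stdG measurableSet_Ioo, integral_indicator_stdG measurableSet_Ioo,
    ← integral_Ioc_eq_integral_Ioo, ← integral_Ioc_eq_integral_Ioo,
    ← intervalIntegral.integral_of_le hRR, ← intervalIntegral.integral_of_le hRR]
  have i1 : IntervalIntegrable (fun w => gaussianPDFReal 0 1 w * (w * (T w - w)))
      volume (-R) R := by
    apply ContinuousOn.intervalIntegrable
    rw [Set.uIcc_of_le hRR]
    fun_prop
  have i2 : IntervalIntegrable (fun w => gaussianPDFReal 0 1 w * (D w - 1)) volume (-R) R := by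
    apply ContinuousOn.intervalIntegrable
    rw [Set.uIcc_of_le hRR]
    fun_prop
  have h := intervalIntegral.integral_eq_sub_of_hasDerivAt (a := -R) (b := R)
    (f := fun w => gaussianPDFReal 0 1 w * (T w - w))
    (f' := fun w => gaussianPDFReal 0 1 w * (D w - 1) - gaussianPDFReal 0 1 w * (w * (T w - w)))
    (fun w hw => by
      rw [Set.uIcc_of_le hRR] at hw
      have := (hasDerivAt_gaussianPDFReal w).mul ((hT w hw).sub (hasDerivAt_id w))
      exact this.congr_deriv (by simp only [Pi.sub_apply, id]; ring)) (i2.sub i1)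
  rw [intervalIntegral.integral_sub i2 i1] at h
  simp only [TL, TR, sub_self, mul_zero] at h
  linarith

/-! ### Reverse hypercontractivity on the line -/

lemma integral_changeOfVar_Ioo {R : ℝ} {T D : ℝ → ℝ} (hm : StrictMono T)
    (TL : T (-R) = -R) (TR : T R = R)
    (hT : ∀ w ∈ Set.Icc (-R) R, HasDerivAt T (D w) w) (hD : ∀ w, 0 < D w) (F : ℝ → ℝ) :
    ∫ w in Set.Ioo (-R) R, F w = ∫ w in Set.Ioo (-R) R, D w * F (T w) := by
  have himg : T '' Set.Ioo (-R) R = Set.Ioo (-R) R := by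
    apply Set.Subset.antisymm
    · rintro _ ⟨x, hx, rfl⟩
      exact ⟨by rw [← TL]; exact hm hx.1, by conv_rhs => rw [← TR]
                                             exact hm hx.2⟩
    · by_cases hRR : -R ≤ R
      · have := intermediate_value_Ioo hRR (f := T)
          (fun w hw => (hT w hw).continuousAt.continuousWithinAt)
        rwa [TL, TR] at this
      · rw [Set.Ioo_eq_empty (by linarith)]; simp
  conv_lhs => rw [← himg]
  rw [integral_image_eq_integral_abs_deriv_smul measurableSet_Ioo
    (fun w hw => (hT w (Set.Ioo_subset_Icc_self hw)).hasDerivWithinAt) hm.injective.injOn]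
  simp [abs_of_pos (hD _)]

/-- Reverse hypercontractivity on the line for a continuous function `g` that is replaced outside
`(-R, R)` by the constant `c` for which `c ^ b ^ 2` is the Gaussian average `M` of `g ^ b ^ 2` over
`[-R, R]`. The transport map can then be continued by the identity. -/
lemma reverse_hyp_frozen {a b : ℝ} (hab : a ^ 2 + b ^ 2 = 1) (hb : 0 < b) {δ : ℝ} (hδ : 0 < δ)
    {g : ℝ → ℝ} (hg : Continuous g) (hgδ : ∀ x, δ ≤ g x) (hg1 : ∀ x, g x ≤ 1) {R : ℝ} (hR : 0 < R)
    {M : ℝ} (hM0 : 0 < M)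
    (hM : M * ∫ x in (-R)..R, gaussianPDFReal 0 1 x =
      ∫ x in (-R)..R, g x ^ (b ^ 2) * gaussianPDFReal 0 1 x) :
    1 / b ^ 2 * Real.log M ≤ ∫ y, Real.log (∫ z, (Set.Ioo (-R) R).piecewise g
      (fun _ => Real.exp (1 / b ^ 2 * Real.log M)) (a * y + b * z) ∂stdG) ∂stdG := by
  have hRR : -R ≤ R := by linarith
  have hb2 : 0 < b ^ 2 := by positivity
  have hg0 : ∀ x, 0 < g x := fun x => hδ.trans_le (hgδ x)
  set φ := gaussianPDFReal 0 1 with hφ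
  have φc : Continuous φ := continuous_gaussianPDFReal
  have φ0 : ∀ x, 0 < φ x := gaussianPDFReal_std_pos
  let q : ℝ → ℝ := fun x => g x ^ (b ^ 2) / M * φ x
  have qc : Continuous q := by
    have : Continuous fun x => g x ^ (b ^ 2) := hg.rpow_const fun x => Or.inl (hg0 x).ne'
    fun_prop
  have q0 : ∀ x, 0 < q x := fun x =>
    mul_pos (div_pos (Real.rpow_pos_of_pos (hg0 x) _) hM0) (φ0 x)
  obtain ⟨T, hTm, TL, TR, hT⟩ := exists_monotone_transport hR φc qc φ0 q0 (by
    have : ∀ x, q x = M⁻¹ * (g x ^ (b ^ 2) * φ x) := fun x => by simp only [q]; ring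
    simp only [this]
    rw [intervalIntegral.integral_const_mul, ← hM]
    field_simp)
  set D : ℝ → ℝ := fun w => φ w / q (T w)
  have D0 : ∀ w, 0 < D w := fun w => div_pos (φ0 _) (q0 _)
  have Tmeas : Measurable T := hTm.monotone.measurable
  have hTc : ContinuousOn T (Set.Icc (-R) R) := fun w hw =>
    (hT w hw).continuousAt.continuousWithinAt
  have Dmeas : Measurable D := φc.measurable.div (qc.measurable.comp Tmeas)
  have hDc : ContinuousOn D (Set.Icc (-R) R) :=
    φc.continuousOn.div (qc.comp_continuousOn hTc) fun w _ => (q0 _).ne'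
  let S : Set ℝ := Set.Ioo (-R) R
  have hS : MeasurableSet S := measurableSet_Ioo
  let τ : ℝ → ℝ := S.indicator fun w => T w - w
  let l : ℝ → ℝ := S.indicator fun w => Real.log (D w)
  have τm : Measurable τ := (Tmeas.sub measurable_id).indicator hS
  have lm : Measurable l := (Real.measurable_log.comp Dmeas).indicator hS
  have bdd : ∀ f : ℝ → ℝ, ContinuousOn f (Set.Icc (-R) R) → ∃ c, ∀ x, |S.indicator f x| ≤ c := by
    intro f hf
    obtain ⟨c, hc⟩ := isCompact_Icc.exists_bound_of_continuousOn hf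
    refine ⟨max c 0, fun x => ?_⟩
    by_cases hx : x ∈ S
    · rw [Set.indicator_of_mem hx]
      exact (hc x (Set.Ioo_subset_Icc_self hx)).trans (le_max_left _ _)
    · rw [Set.indicator_of_notMem hx]; simp
  obtain ⟨cτ, hcτ⟩ := bdd _ (hTc.sub continuousOn_id)
  obtain ⟨cl, hcl⟩ := bdd _ (hDc.log fun w _ => (D0 w).ne')
  -- `L y w` is the logarithm of the transported integrand, relative to the Gaussian density of
  -- mean `a y` and variance `b ^ 2`. It is affine in `y` because the terms `T w ^ 2` cancel.
  let L : ℝ → ℝ → ℝ := fun y w =>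
    1 / b ^ 2 * Real.log M + a / b ^ 2 * (y * τ w) - (1 - b ^ 2) / b ^ 2 * l w
  have Lm : Measurable fun p : ℝ × ℝ => L p.1 (a * p.1 + b * p.2) := by
    simp only [L]; fun_prop
  have Lb : ∀ y, ∃ c, ∀ w, |L y w| ≤ c := by
    intro y
    refine ⟨|1 / b ^ 2 * Real.log M| + |a / b ^ 2| * (|y| * cτ) + |(1 - b ^ 2) / b ^ 2| * cl,
      fun w => ?_⟩
    refine (abs_sub _ _).trans ?_
    rw [abs_mul ((1 - b ^ 2) / b ^ 2)]
    refine add_le_add ((abs_add_le _ _).trans ?_) (by gcongr; exact hcl w)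
    rw [abs_mul (a / b ^ 2), abs_mul y]
    gcongr
    exact hcτ w
  -- Pointwise comparison of the densities.
  have hpt : ∀ y, ∀ w ∈ S,
      D w * (gaussianPDFReal (a * y) (NNReal.mk (b ^ 2) (sq_nonneg b)) (T w) * g (T w)) =
      gaussianPDFReal (a * y) (NNReal.mk (b ^ 2) (sq_nonneg b)) w * Real.exp (L y w) := by
    intro y w hw
    have hlog : Real.log (D w) =
        -w ^ 2 / 2 + T w ^ 2 / 2 - b ^ 2 * Real.log (g (T w)) + Real.log M := by
      have e1 : ∀ x, Real.log (φ x) = Real.log (Real.sqrt (2 * Real.pi))⁻¹ - x ^ 2 / 2 := by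
        intro x
        simp only [hφ, gaussianPDFReal]
        rw [Real.log_mul (by positivity) (Real.exp_pos _).ne', Real.log_exp]
        simp
        ring
      rw [Real.log_div (φ0 _).ne' (q0 _).ne']
      simp only [q]
      rw [Real.log_mul (div_pos (Real.rpow_pos_of_pos (hg0 _) _) hM0).ne' (φ0 _).ne',
        Real.log_div (Real.rpow_pos_of_pos (hg0 _) _).ne' hM0.ne', Real.log_rpow (hg0 _), e1, e1]
      ring
    have hgT : g (T w) =
        Real.exp ((Real.log M - Real.log (D w) - w ^ 2 / 2 + T w ^ 2 / 2) / b ^ 2) := by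
      rw [hlog, ← Real.exp_log (hg0 (T w))]
      congr 1
      rw [Real.log_exp]
      field_simp
      ring
    conv_lhs => rw [← Real.exp_log (D0 w)]
    rw [hgT]
    simp only [gaussianPDFReal, NNReal.coe_mk, L, τ, l, Set.indicator_of_mem hw]
    rw [mul_assoc, mul_left_comm, ← Real.exp_add, ← Real.exp_add, mul_assoc, mul_assoc,
      ← Real.exp_add]
    congr 2
    field_simp
    ring
  have hker : ∀ y, ∫ z, S.piecewise g (fun _ => Real.exp (1 / b ^ 2 * Real.log M))
      (a * y + b * z) ∂stdG =
      ∫ z, Real.exp (L y (a * y + b * z)) ∂stdG := by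
    intro y
    have m1 : Measurable (S.piecewise g (fun _ => Real.exp (1 / b ^ 2 * Real.log M))) :=
      Measurable.piecewise hS hg.measurable measurable_const
    have m2 : Measurable fun w => Real.exp (L y w) := by simp only [L]; fun_prop
    rw [integral_stdG_affine hb (a * y) m1, integral_stdG_affine hb (a * y) m2]
    set p := gaussianPDFReal (a * y) (NNReal.mk (b ^ 2) (sq_nonneg b)) with hp
    have ip : Integrable p := integrable_gaussianPDFReal _ _
    have i1 : Integrable fun w => p w *
        S.piecewise g (fun _ => Real.exp (1 / b ^ 2 * Real.log M)) w := by
      refine ip.mul_bdd (c := max 1 (Real.exp (1 / b ^ 2 * Real.log M))) m1.aestronglyMeasurable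
        (Filter.Eventually.of_forall fun w => ?_)
      by_cases hw : w ∈ S
      · rw [Set.piecewise_eq_of_mem _ _ _ hw, Real.norm_of_nonneg (hg0 w).le]
        exact (hg1 w).trans (le_max_left _ _)
      · rw [Set.piecewise_eq_of_notMem _ _ _ hw, Real.norm_of_nonneg (Real.exp_pos _).le]
        exact le_max_right _ _
    have i2 : Integrable fun w => p w * Real.exp (L y w) := by
      obtain ⟨c, hc⟩ := Lb y
      refine ip.mul_bdd (c := Real.exp c) m2.aestronglyMeasurable
        (Filter.Eventually.of_forall fun w => ?_)
      rw [Real.norm_of_nonneg (Real.exp_pos _).le]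
      exact Real.exp_le_exp.2 ((le_abs_self _).trans (hc w))
    rw [← integral_add_compl hS i1, ← integral_add_compl hS i2]
    congr 1
    · rw [setIntegral_congr_fun hS (g := fun w => p w * g w) (fun w hw => by
        simp only [Set.piecewise_eq_of_mem _ _ _ hw]),
        integral_changeOfVar_Ioo hTm TL TR hT D0]
      exact setIntegral_congr_fun hS fun w hw => hpt y w hw
    · refine setIntegral_congr_fun hS.compl fun w hw => ?_
      simp only [Set.piecewise_eq_of_notMem _ _ _ hw, L, τ, l, Set.indicator_of_notMem hw]
      simp
  have iL : Integrable (fun p : ℝ × ℝ => L p.1 (a * p.1 + b * p.2)) (stdG.prod stdG) := by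
    refine ((integrable_const _).add ((integrable_fst_mul_comp τm hcτ).const_mul _)).sub
      (Integrable.const_mul (integrable_of_bdd (by fun_prop) fun _ => hcl _) _)
  -- Averaging over `y` turns the coefficient `a y` of `τ` into `a ^ 2 w = (1 - b ^ 2) w`.
  have hmain : 1 / b ^ 2 * Real.log M ≤ ∫ y, ∫ z, L y (a * y + b * z) ∂stdG ∂stdG := by
    have hτi : ∀ y, Integrable (fun z => y * τ (a * y + b * z)) stdG := fun y =>
      (integrable_of_bdd (by fun_prop) fun _ => hcτ _).const_mul y
    have hli : ∀ y, Integrable (fun z => l (a * y + b * z)) stdG := fun y =>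
      integrable_of_bdd (by fun_prop) fun _ => hcl _
    have h1 : ∀ y, ∫ z, L y (a * y + b * z) ∂stdG = 1 / b ^ 2 * Real.log M +
        a / b ^ 2 * ∫ z, y * τ (a * y + b * z) ∂stdG -
        (1 - b ^ 2) / b ^ 2 * ∫ z, l (a * y + b * z) ∂stdG := by
      intro y
      simp only [L]
      exact integral_const_add_sub (hτi y) (hli y) _ _ _
    simp only [h1]
    have j1 : Integrable (fun y => ∫ z, y * τ (a * y + b * z) ∂stdG) stdG :=
      (integrable_fst_mul_comp (a := a) (b := b) τm hcτ).integral_prod_left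
    have j2 : Integrable (fun y => ∫ z, l (a * y + b * z) ∂stdG) stdG :=
      Integrable.integral_prod_left (f := fun p : ℝ × ℝ => l (a * p.1 + b * p.2))
        (integrable_of_bdd (by fun_prop) fun _ => hcl _)
    rw [integral_const_add_sub j1 j2, integral_fst_mul_comp hab hb τm hcτ,
      integral_comp_rotate hab hb lm hcl]
    -- Integration by parts and `log t ≤ t - 1`.
    have h2 : ∫ w, l w ∂stdG ≤ ∫ w, w * τ w ∂stdG := by
      have e : ∀ w, w * τ w = S.indicator (fun w => w * (T w - w)) w := fun w => by
        by_cases hw : w ∈ S <;> simp [τ, hw]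
      simp only [e]
      rw [gaussian_stein_transport hR TL TR hT hDc]
      obtain ⟨cd, hcd⟩ := bdd _ (hDc.sub (continuousOn_const (c := (1 : ℝ))))
      refine integral_mono (integrable_of_bdd lm hcl)
        (integrable_of_bdd ((Dmeas.sub measurable_const).indicator hS) hcd) fun w => ?_
      exact Set.indicator_le_indicator (Real.log_le_sub_one_of_pos (D0 w))
    have h3 : 0 ≤ (1 - b ^ 2) / b ^ 2 * (∫ w, w * τ w ∂stdG - ∫ w, l w ∂stdG) :=
      mul_nonneg (div_nonneg (by nlinarith) hb2.le) (by linarith)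
    have h4 : a / b ^ 2 * (a * ∫ w, w * τ w ∂stdG) = (1 - b ^ 2) / b ^ 2 * ∫ w, w * τ w ∂stdG := by
      rw [← hab]; ring
    rw [h4]
    linarith
  refine hmain.trans ?_
  have hcpos : 0 < Real.exp (1 / b ^ 2 * Real.log M) := Real.exp_pos _
  set c := Real.exp (1 / b ^ 2 * Real.log M)
  have mP : Measurable (S.piecewise g (fun _ => c)) :=
    Measurable.piecewise hS hg.measurable measurable_const
  have hmem : ∀ x, S.piecewise g (fun _ => c) x ∈ Set.Icc (min δ c) (max 1 c) := fun x => by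
    by_cases hx : x ∈ S
    · rw [Set.piecewise_eq_of_mem _ _ _ hx]
      exact ⟨(min_le_left _ _).trans (hgδ x), (hg1 x).trans (le_max_left _ _)⟩
    · rw [Set.piecewise_eq_of_notMem _ _ _ hx]
      exact ⟨min_le_right _ _, le_max_right _ _⟩
  refine integral_mono iL.integral_prod_left (integrable_log_integral stdG stdG
    (F := fun y z => S.piecewise g (fun _ => c) (a * y + b * z)) (by fun_prop) (lt_min hδ hcpos)
    fun _ _ => hmem _) fun y => ?_
  obtain ⟨C, hC⟩ := Lb y
  have mL : Measurable fun z => L y (a * y + b * z) := Lm.comp measurable_prodMk_left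
  have := exp_jensen (μ := stdG) (integrable_of_bdd mL fun _ => hC _)
    (integrable_of_bdd (c := Real.exp C) (Real.measurable_exp.comp mL) fun z => by
      rw [abs_of_pos (Real.exp_pos _)]
      exact Real.exp_le_exp.2 ((le_abs_self _).trans (hC _)))
  rw [← hker] at this
  exact this

/-- Passage to the limit in lower bounds for `E_y log E_z G(a y + b z)`, along functions with values
in a fixed compact subset of `(0, ∞)` that converge almost everywhere. -/
lemma le_integral_log_of_tendsto {a b : ℝ} (hb : 0 < b) {c C : ℝ} (hc : 0 < c)
    {G : ℕ → ℝ → ℝ} {g : ℝ → ℝ} (hG : ∀ k, Measurable (G k)) (hg : Measurable g)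
    (hGm : ∀ k x, G k x ∈ Set.Icc c C) (hgm : ∀ x, g x ∈ Set.Icc c C)
    (hlim : ∀ᵐ x, Filter.Tendsto (fun k => G k x) Filter.atTop (𝓝 (g x)))
    {r : ℕ → ℝ} {s : ℝ} (hr : Filter.Tendsto r Filter.atTop (𝓝 s))
    (h : ∀ k, r k ≤ ∫ y, Real.log (∫ z, G k (a * y + b * z) ∂stdG) ∂stdG) :
    s ≤ ∫ y, Real.log (∫ z, g (a * y + b * z) ∂stdG) ∂stdG := by
  have habs : ∀ x ∈ Set.Icc c C, ‖x‖ ≤ C := fun x hx => by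
    rw [Real.norm_of_nonneg (hc.le.trans hx.1)]; exact hx.2
  have hin : ∀ y, Filter.Tendsto (fun k => ∫ z, G k (a * y + b * z) ∂stdG) Filter.atTop
      (𝓝 (∫ z, g (a * y + b * z) ∂stdG)) := by
    intro y
    refine tendsto_integral_of_dominated_convergence (fun _ => C)
      (fun k => ((hG k).comp (by fun_prop)).aestronglyMeasurable) (integrable_const _)
      (fun k => Filter.Eventually.of_forall fun z => habs _ (hGm k _)) ?_
    have hac : stdG.map (fun z => a * y + b * z) ≪ volume := by
      rw [map_affine_stdG]
      exact gaussianReal_absolutelyContinuous _ (mk_sq_ne_zero hb)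
    exact ae_of_ae_map (by fun_prop) (hac.ae_le hlim)
  have hIm : ∀ k y, ∫ z, G k (a * y + b * z) ∂stdG ∈ Set.Icc c C := fun k y =>
    integral_mem_Icc ((hG k).comp (by fun_prop)) fun z => hGm k _
  have hIg : ∀ y, ∫ z, g (a * y + b * z) ∂stdG ∈ Set.Icc c C := fun y =>
    integral_mem_Icc (hg.comp (by fun_prop)) fun z => hgm _
  refine le_of_tendsto_of_tendsto' hr ?_ h
  refine tendsto_integral_of_dominated_convergence (fun _ => max |Real.log c| |Real.log C|)
    (fun k => (integrable_log_integral stdG stdG (F := fun y z => G k (a * y + b * z)) (by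
      have := hG k
      fun_prop) hc fun _ _ => hGm k _).aestronglyMeasurable) (integrable_const _)
    (fun k => Filter.Eventually.of_forall fun y => ?_)
    (Filter.Eventually.of_forall fun y => ?_)
  · have := log_mem_Icc hc (hIm k y)
    exact abs_le_max_abs_abs this.1 this.2
  · exact ((Real.continuousAt_log (hc.trans_le (hIg y).1).ne').tendsto).comp (hin y)

lemma reverse_hyp_line_of_continuous {a b : ℝ} (hab : a ^ 2 + b ^ 2 = 1) (hb : 0 < b) {δ : ℝ}
    (hδ : 0 < δ) {g : ℝ → ℝ} (hg : Continuous g) (hgm : ∀ x, g x ∈ Set.Icc δ 1) :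
    1 / b ^ 2 * Real.log (∫ x, g x ^ (b ^ 2) ∂stdG) ≤
      ∫ y, Real.log (∫ z, g (a * y + b * z) ∂stdG) ∂stdG := by
  have hb2 : 0 < b ^ 2 := by positivity
  have hg0 : ∀ x, 0 < g x := fun x => hδ.trans_le (hgm x).1
  have hgc : Continuous fun x => g x ^ (b ^ 2) := hg.rpow_const fun x => Or.inl (hg0 x).ne'
  have hpm : ∀ x, g x ^ (b ^ 2) ∈ Set.Icc (δ ^ (b ^ 2)) 1 := fun x =>
    ⟨Real.rpow_le_rpow hδ.le (hgm x).1 hb2.le, Real.rpow_le_one (hg0 x).le (hgm x).2 hb2.le⟩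
  set φ := gaussianPDFReal 0 1 with hφ
  have φc : Continuous φ := continuous_gaussianPDFReal
  have φ0 : ∀ x, 0 < φ x := gaussianPDFReal_std_pos
  have φi : Integrable φ := integrable_gaussianPDFReal _ _
  have gφi : Integrable fun x => g x ^ (b ^ 2) * φ x :=
    φi.bdd_mul (c := 1) hgc.aestronglyMeasurable (Filter.Eventually.of_forall fun x => by
      rw [Real.norm_of_nonneg (Real.rpow_pos_of_pos (hg0 x) _).le]; exact (hpm x).2)
  let R : ℕ → ℝ := fun k => k + 1
  have hR : ∀ k, 0 < R k := fun k => by positivity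
  have hRt : Filter.Tendsto R Filter.atTop Filter.atTop :=
    Filter.tendsto_atTop_add_const_right _ _ tendsto_natCast_atTop_atTop
  let I : ℕ → ℝ := fun k => ∫ x in (-R k)..R k, φ x
  let J : ℕ → ℝ := fun k => ∫ x in (-R k)..R k, g x ^ (b ^ 2) * φ x
  have I0 : ∀ k, 0 < I k := fun k =>
    intervalIntegral.intervalIntegral_pos_of_pos (φc.intervalIntegrable _ _) φ0
      (by linarith [hR k])
  have hI : Filter.Tendsto I Filter.atTop (𝓝 1) := by
    have := intervalIntegral_tendsto_integral φi (Filter.tendsto_neg_atTop_atBot.comp hRt) hRt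
    rwa [integral_gaussianPDFReal_eq_one _ one_ne_zero] at this
  have hJ : Filter.Tendsto J Filter.atTop (𝓝 (∫ x, g x ^ (b ^ 2) ∂stdG)) := by
    have := intervalIntegral_tendsto_integral gφi (Filter.tendsto_neg_atTop_atBot.comp hRt) hRt
    have e : ∫ x, g x ^ (b ^ 2) ∂stdG = ∫ x, g x ^ (b ^ 2) * φ x := by
      rw [integral_gaussianReal_eq_integral_smul one_ne_zero]
      exact integral_congr_ae (Filter.Eventually.of_forall fun x => mul_comm _ _)
    rw [e]
    exact this
  have hMm : ∀ k, J k / I k ∈ Set.Icc (δ ^ (b ^ 2)) 1 := by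
    intro k
    have hRR : -R k ≤ R k := by linarith [hR k]
    have ig : IntervalIntegrable (fun x => g x ^ (b ^ 2) * φ x) volume (-R k) (R k) :=
      gφi.intervalIntegrable
    constructor
    · rw [le_div_iff₀ (I0 k), ← intervalIntegral.integral_const_mul]
      exact intervalIntegral.integral_mono hRR (φi.intervalIntegrable.const_mul _) ig fun x =>
        mul_le_mul_of_nonneg_right (hpm x).1 (φ0 x).le
    · rw [div_le_one (I0 k)]
      exact intervalIntegral.integral_mono hRR ig φi.intervalIntegrable fun x =>
        mul_le_of_le_one_left (φ0 x).le (hpm x).2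
  have hδp : 0 < δ ^ (b ^ 2) := Real.rpow_pos_of_pos hδ _
  have hM0 : ∀ k, 0 < J k / I k := fun k => hδp.trans_le (hMm k).1
  have hcm : ∀ k, Real.exp (1 / b ^ 2 * Real.log (J k / I k)) ∈ Set.Icc δ 1 := by
    intro k
    have h1 := log_mem_Icc hδp (hMm k)
    rw [Real.log_rpow hδ, Real.log_one] at h1
    constructor
    · rw [← Real.log_le_iff_le_exp hδ, one_div, ← div_eq_inv_mul, le_div_iff₀ hb2, mul_comm]
      exact h1.1
    · rw [Real.exp_le_one_iff]
      exact mul_nonpos_of_nonneg_of_nonpos (by positivity) h1.2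
  have hpos : 0 < ∫ x, g x ^ (b ^ 2) ∂stdG := hδp.trans_le (integral_mem_Icc hgc.measurable hpm).1
  refine le_integral_log_of_tendsto hb hδ
    (G := fun k => (Set.Ioo (-R k) (R k)).piecewise g
      fun _ => Real.exp (1 / b ^ 2 * Real.log (J k / I k)))
    (r := fun k => 1 / b ^ 2 * Real.log (J k / I k))
    (fun k => Measurable.piecewise measurableSet_Ioo hg.measurable measurable_const)
    hg.measurable (fun k x => ?_) hgm (Filter.Eventually.of_forall fun x => ?_) ?_ fun k => ?_
  · by_cases hx : x ∈ Set.Ioo (-R k) (R k)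
    · rw [Set.piecewise_eq_of_mem _ _ _ hx]; exact hgm x
    · rw [Set.piecewise_eq_of_notMem _ _ _ hx]; exact hcm k
  · refine tendsto_const_nhds.congr' ?_
    filter_upwards [hRt.eventually_gt_atTop |x|] with k hk
    rw [Set.piecewise_eq_of_mem]
    exact abs_lt.1 hk
  · have := hJ.div hI one_ne_zero
    rw [div_one] at this
    exact (((Real.continuousAt_log hpos.ne').tendsto).comp this).const_mul _
  · exact reverse_hyp_frozen hab hb hδ hg (fun x => (hgm x).1) (fun x => (hgm x).2) (hR k) (hM0 k)
      (div_mul_cancel₀ _ (I0 k).ne')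

lemma exists_continuous_ae_tendsto {μ : Measure ℝ} [IsFiniteMeasure μ] {g : ℝ → ℝ}
    (hg : Measurable g) {c C : ℝ} (hgm : ∀ x, g x ∈ Set.Icc c C) :
    ∃ G : ℕ → ℝ → ℝ, (∀ k, Continuous (G k)) ∧ (∀ k x, G k x ∈ Set.Icc c C) ∧
      ∀ᵐ x ∂μ, Filter.Tendsto (fun k => G k x) Filter.atTop (𝓝 (g x)) := by
  have hcC : c ≤ C := (hgm 0).1.trans (hgm 0).2
  have hL : MemLp g 1 μ := memLp_one_iff_integrable.2
    (Integrable.of_mem_Icc c C hg.aemeasurable (Filter.Eventually.of_forall hgm))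
  have h1 : ∀ k : ℕ, ∃ F : BoundedContinuousFunction ℝ ℝ,
      eLpNorm (g - (F : ℝ → ℝ)) 1 μ ≤ ENNReal.ofReal (1 / (k + 1 : ℝ)) := fun k => by
    obtain ⟨F, hF, _⟩ := hL.exists_boundedContinuous_eLpNorm_sub_le ENNReal.one_ne_top
      (ε := ENNReal.ofReal (1 / (k + 1 : ℝ))) (by simp; positivity)
    exact ⟨F, hF⟩
  choose F hF using h1
  have hT : TendstoInMeasure μ (fun k x => F k x) Filter.atTop g := by
    refine tendstoInMeasure_of_tendsto_eLpNorm one_ne_zero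
      (fun k => (F k).continuous.aestronglyMeasurable) hg.aestronglyMeasurable ?_
    have h0 : Filter.Tendsto (fun k : ℕ => ENNReal.ofReal (1 / (k + 1 : ℝ)))
        Filter.atTop (𝓝 0) := by
      have := ENNReal.tendsto_ofReal (tendsto_one_div_add_atTop_nhds_zero_nat (𝕜 := ℝ))
      rwa [ENNReal.ofReal_zero] at this
    refine tendsto_of_tendsto_of_tendsto_of_le_of_le tendsto_const_nhds h0
      (fun _ => zero_le) fun k => ?_
    dsimp only
    rw [eLpNorm_sub_comm]
    exact hF k
  obtain ⟨ns, -, hns⟩ := hT.exists_seq_tendsto_ae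
  refine ⟨fun k x => max c (min C (F (ns k) x)), fun k => ?_, fun k x =>
    ⟨le_max_left _ _, max_le hcC (min_le_left _ _)⟩, ?_⟩
  · have := (F (ns k)).continuous
    fun_prop
  · filter_upwards [hns] with x hx
    have := (tendsto_const_nhds (x := c)).max ((tendsto_const_nhds (x := C)).min hx)
    rwa [min_eq_right (hgm x).2, max_eq_right (hgm x).1] at this

/-- Borell's reverse hypercontractive inequality on the line, from the exponent `b ^ 2` to the
exponent `0`. Values in `[δ, 1]` keep all the logarithms bounded. -/
theorem reverse_hyp_line {a b : ℝ} (hab : a ^ 2 + b ^ 2 = 1) (hb : 0 < b) {δ : ℝ}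
    (hδ : 0 < δ) {g : ℝ → ℝ} (hg : Measurable g) (hgm : ∀ x, g x ∈ Set.Icc δ 1) :
    1 / b ^ 2 * Real.log (∫ x, g x ^ (b ^ 2) ∂stdG) ≤
      ∫ y, Real.log (∫ z, g (a * y + b * z) ∂stdG) ∂stdG := by
  have hb2 : 0 < b ^ 2 := by positivity
  obtain ⟨G, hGc, hGm, hlim⟩ := exists_continuous_ae_tendsto (μ := stdG) hg hgm
  have hpow : ∀ t ∈ Set.Icc δ 1, t ^ (b ^ 2) ∈ Set.Icc (δ ^ (b ^ 2)) 1 := fun t ht =>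
    ⟨Real.rpow_le_rpow hδ.le ht.1 hb2.le, Real.rpow_le_one (hδ.le.trans ht.1) ht.2 hb2.le⟩
  have hδp : 0 < δ ^ (b ^ 2) := Real.rpow_pos_of_pos hδ _
  refine le_integral_log_of_tendsto hb hδ (fun k => (hGc k).measurable) hg hGm hgm
    ((gaussianReal_absolutelyContinuous' 0 one_ne_zero).ae_le hlim)
    (r := fun k => 1 / b ^ 2 * Real.log (∫ x, G k x ^ (b ^ 2) ∂stdG)) ?_
    fun k => reverse_hyp_line_of_continuous hab hb hδ (hGc k) (hGm k)
  have hpos : 0 < ∫ x, g x ^ (b ^ 2) ∂stdG :=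
    hδp.trans_le (integral_mem_Icc (by fun_prop) fun x => hpow _ (hgm x)).1
  refine Filter.Tendsto.const_mul _ (((Real.continuousAt_log hpos.ne').tendsto).comp ?_)
  refine tendsto_integral_of_dominated_convergence (fun _ => 1)
    (fun k => ((hGc k).measurable.pow_const _).aestronglyMeasurable) (integrable_const _)
    (fun k => Filter.Eventually.of_forall fun x => ?_) ?_
  · have := hpow _ (hGm k x)
    rw [Real.norm_of_nonneg (hδp.le.trans this.1)]
    exact this.2
  · filter_upwards [hlim] with x hx
    exact hx.rpow_const (Or.inr hb2.le)

/-! ### Superadditivity of geometric means -/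

/-- Reverse Minkowski inequality for the geometric mean: the geometric mean over `y` of the integral
over `x` is at least the integral over `x` of the geometric means over `y`. -/
lemma log_integral_exp_le {α β : Type*} [MeasurableSpace α] [MeasurableSpace β]
    (μ : Measure α) [IsProbabilityMeasure μ] (ν : Measure β) [IsProbabilityMeasure ν]
    {F : α → β → ℝ} (hF : Measurable fun p : α × β => F p.1 p.2) {c C : ℝ} (hc : 0 < c)
    (h : ∀ x y, F x y ∈ Set.Icc c C) :
    Real.log (∫ x, Real.exp (∫ y, Real.log (F x y) ∂ν) ∂μ) ≤
      ∫ y, Real.log (∫ x, F x y ∂μ) ∂ν := by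
  have hC : ∀ x y, 0 < C := fun x y => hc.trans_le ((h x y).1.trans (h x y).2)
  have F0 : ∀ x y, 0 < F x y := fun x y => hc.trans_le (h x y).1
  have hlF : Measurable fun p : α × β => Real.log (F p.1 p.2) := Real.measurable_log.comp hF
  have hF' : Measurable fun p : β × α => F p.2 p.1 := hF.comp measurable_swap
  have hFx : ∀ x, Measurable (F x) := fun x => hF.comp measurable_prodMk_left
  have hFy : ∀ y, Measurable fun x => F x y := fun y => hF.comp measurable_prodMk_right
  have ilF : ∀ x, Integrable (fun y => Real.log (F x y)) ν := fun x =>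
    integrable_of_mem_Icc (Real.measurable_log.comp (hFx x)) fun y => log_mem_Icc hc (h x y)
  set m : α → ℝ := fun x => Real.exp (∫ y, Real.log (F x y) ∂ν) with hm
  have m0 : ∀ x, 0 < m x := fun x => Real.exp_pos _
  have mm : Measurable m := Real.measurable_exp.comp (measurable_integral_right ν hlF)
  have mmem : ∀ x, m x ∈ Set.Icc (Real.exp (Real.log c)) (Real.exp (Real.log C)) := fun x => by
    have := integral_mem_Icc (μ := ν) (Real.measurable_log.comp (hFx x))
      fun y => log_mem_Icc hc (h x y)
    exact ⟨Real.exp_le_exp.2 this.1, Real.exp_le_exp.2 this.2⟩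
  have im : Integrable m μ := integrable_of_mem_Icc mm mmem
  set M := ∫ x, m x ∂μ with hM
  have M0 : 0 < M := (Real.exp_pos _).trans_le (integral_mem_Icc mm mmem).1
  set H : β → ℝ := fun y => ∫ x, F x y ∂μ
  have Hm : Measurable H := measurable_integral_right μ (F := fun y x => F x y) hF'
  have Hmem : ∀ y, H y ∈ Set.Icc c C := fun y => integral_mem_Icc (hFy y) fun x => h x y
  have H0 : ∀ y, 0 < H y := fun y => hc.trans_le (Hmem y).1
  have ilH : Integrable (fun y => Real.log (H y)) ν :=
    integrable_of_mem_Icc (Real.measurable_log.comp Hm) fun y => log_mem_Icc hc (Hmem y)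
  set K := ∫ y, Real.log (H y) ∂ν
  have qm : Measurable fun p : α × β => F p.1 p.2 / H p.2 := hF.div (Hm.comp measurable_snd)
  have qmem : ∀ x y, F x y / H y ∈ Set.Icc 0 (C / c) := fun x y =>
    ⟨(div_pos (F0 x y) (H0 y)).le, div_le_div₀ (hC x y).le (h x y).2 hc (Hmem y).1⟩
  have iq : Integrable (fun p : α × β => F p.1 p.2 / H p.2) (μ.prod ν) :=
    integrable_of_mem_Icc qm fun p => qmem p.1 p.2
  have iqx : ∀ x, Integrable (fun y => F x y / H y) ν := fun x =>
    integrable_of_mem_Icc (qm.comp measurable_prodMk_left) (qmem x)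
  -- `log t ≤ t - 1` for `t = F x y * M / (m x * H y)`, averaged with the weight `m x / M`.
  have h1 : ∀ x, m x / M * (Real.log M - K) ≤ ∫ y, F x y / H y ∂ν - m x / M := by
    intro x
    have h2 : ∀ y, m x / M * ((Real.log (F x y) - Real.log (H y)) + (Real.log M - Real.log (m x))) ≤
        F x y / H y - m x / M := by
      intro y
      have h3 := Real.log_le_sub_one_of_pos
        (div_pos (mul_pos (F0 x y) M0) (mul_pos (m0 x) (H0 y)))
      rw [Real.log_div (mul_pos (F0 x y) M0).ne' (mul_pos (m0 x) (H0 y)).ne',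
        Real.log_mul (F0 x y).ne' M0.ne', Real.log_mul (m0 x).ne' (H0 y).ne'] at h3
      have h4 := mul_le_mul_of_nonneg_left h3 (div_pos (m0 x) M0).le
      have e : m x / M * (F x y * M / (m x * H y) - 1) = F x y / H y - m x / M := by
        have := (m0 x).ne'
        have := (H0 y).ne'
        field_simp
      rw [e] at h4
      refine le_trans (le_of_eq ?_) h4
      ring
    have i2 : Integrable (fun y => Real.log (F x y) - Real.log (H y)) ν := (ilF x).sub ilH
    have h5 : ∫ y, m x / M * ((Real.log (F x y) - Real.log (H y)) +
        (Real.log M - Real.log (m x))) ∂ν ≤ ∫ y, (F x y / H y - m x / M) ∂ν :=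
      integral_mono ((i2.add (integrable_const _)).const_mul _)
        ((iqx x).sub (integrable_const _)) h2
    rw [integral_const_mul, integral_sub (iqx x) (integrable_const _),
      integral_add i2 (integrable_const _), integral_sub (ilF x) ilH] at h5
    have e : Real.log (m x) = ∫ y, Real.log (F x y) ∂ν := by simp [hm]
    rw [← e] at h5
    simp only [integral_const, probReal_univ, smul_eq_mul, one_mul] at h5
    refine le_trans (le_of_eq ?_) h5
    ring
  have iq' : Integrable (fun x => ∫ y, F x y / H y ∂ν) μ := iq.integral_prod_left
  have h6 : ∫ x, m x / M * (Real.log M - K) ∂μ ≤ ∫ x, (∫ y, F x y / H y ∂ν - m x / M) ∂μ :=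
    integral_mono ((im.div_const M).mul_const _) (iq'.sub (im.div_const M)) h1
  rw [integral_mul_const, integral_sub iq' (im.div_const M), integral_div,
    ← hM, div_self M0.ne', integral_integral_swap iq] at h6
  have h7 : ∀ y, ∫ x, F x y / H y ∂μ = 1 := fun y => by
    rw [integral_div]; exact div_self (H0 y).ne'
  simp only [h7] at h6
  simp at h6
  linarith

/-! ### Reverse hypercontractivity in `ℝⁿ` -/

/-- The standard Gaussian measure on `ℝⁿ`. -/
noncomputable abbrev stdGn (n : ℕ) : Measure (Fin n → ℝ) := Measure.pi fun _ => stdG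

lemma measurable_cons {n : ℕ} :
    Measurable fun p : ℝ × (Fin n → ℝ) => (Fin.cons p.1 p.2 : Fin (n + 1) → ℝ) := by
  rw [measurable_pi_iff]
  intro i
  refine Fin.cases ?_ (fun j => ?_) i
  · simpa using measurable_fst
  · simp only [Fin.cons_succ]; fun_prop

lemma integral_stdGn_succ {n : ℕ} {F : (Fin (n + 1) → ℝ) → ℝ} (hF : Measurable F) {c C : ℝ}
    (h : ∀ x, F x ∈ Set.Icc c C) :
    ∫ x, F x ∂stdGn (n + 1) = ∫ t, ∫ x, F (Fin.cons t x) ∂stdGn n ∂stdG := by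
  have h1 := ((measurePreserving_piFinSuccAbove (fun _ : Fin (n + 1) => stdG) 0).symm)
  rw [← integral_prod (f := fun p : ℝ × (Fin n → ℝ) => F (Fin.cons p.1 p.2))
    (integrable_of_mem_Icc (hF.comp measurable_cons) fun p => h _)]
  rw [← h1.integral_comp']
  congr 1
  ext p
  rw [← Fin.insertNth_zero']
  rfl

/-- Borell's reverse hypercontractive inequality in `ℝⁿ`, from the exponent `b ^ 2` to the exponent
`0`. The constant does not depend on `n`: the inequality passes from a factor to the product by
`log_integral_exp_le`. -/
theorem reverse_hyp {a b : ℝ} (hab : a ^ 2 + b ^ 2 = 1) (hb : 0 < b) {δ : ℝ}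
    (hδ : 0 < δ) (n : ℕ) {g : (Fin n → ℝ) → ℝ} (hg : Measurable g)
    (hgm : ∀ x, g x ∈ Set.Icc δ 1) :
    1 / b ^ 2 * Real.log (∫ x, g x ^ (b ^ 2) ∂stdGn n) ≤
      ∫ y, Real.log (∫ z, g (fun i => a * y i + b * z i) ∂stdGn n) ∂stdGn n := by
  have hb2 : 0 < b ^ 2 := by positivity
  have hpow : ∀ t ∈ Set.Icc δ 1, t ^ (b ^ 2) ∈ Set.Icc (δ ^ (b ^ 2)) 1 := fun t ht =>
    ⟨Real.rpow_le_rpow hδ.le ht.1 hb2.le, Real.rpow_le_one (hδ.le.trans ht.1) ht.2 hb2.le⟩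
  have hδp : 0 < δ ^ (b ^ 2) := Real.rpow_pos_of_pos hδ _
  induction n with
  | zero =>
    have e : ∀ x, g x = g 0 := fun x => congrArg g (Subsingleton.elim _ _)
    have h0 : 0 < g 0 := hδ.trans_le (hgm 0).1
    simp only [e, integral_const, probReal_univ, smul_eq_mul, one_mul, Real.log_rpow h0]
    rw [one_div, inv_mul_cancel_left₀ hb2.ne']
  | succ n ih =>
    let G : ℝ → (Fin n → ℝ) → ℝ := fun t x => g (Fin.cons t x)
    have Gm : Measurable fun p : ℝ × (Fin n → ℝ) => G p.1 p.2 := hg.comp measurable_cons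
    let A : (Fin n → ℝ) → (Fin n → ℝ) → (Fin n → ℝ) := fun y z i => a * y i + b * z i
    have Am : Measurable fun p : (Fin n → ℝ) × (Fin n → ℝ) => A p.1 p.2 := by
      simp only [A]; fun_prop
    let U : ℝ → (Fin n → ℝ) → ℝ := fun t y => ∫ z, G t (A y z) ∂stdGn n
    have Um : Measurable fun p : ℝ × (Fin n → ℝ) => U p.1 p.2 :=
      measurable_integral_right (α := ℝ × (Fin n → ℝ)) (stdGn n) (F := fun p z => G p.1 (A p.2 z))
        (Gm.comp ((measurable_fst.comp measurable_fst).prodMk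
          (Am.comp ((measurable_snd.comp measurable_fst).prodMk measurable_snd))))
    have Umem : ∀ t y, U t y ∈ Set.Icc δ 1 := fun t y =>
      integral_mem_Icc (Gm.comp (measurable_const.prodMk (Am.comp measurable_prodMk_left)))
        fun z => hgm _
    have U0 : ∀ t y, 0 < U t y := fun t y => hδ.trans_le (Umem t y).1
    have hA : Measurable fun p : (Fin (n + 1) → ℝ) × (Fin (n + 1) → ℝ) =>
        g (fun i => a * p.1 i + b * p.2 i) := hg.comp (by fun_prop)
    have hcons : ∀ (s t : ℝ) (y z : Fin n → ℝ),
        (fun i => a * (Fin.cons s y : Fin (n + 1) → ℝ) i + b * (Fin.cons t z : Fin (n + 1) → ℝ) i) =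
          Fin.cons (a * s + b * t) (A y z) := by
      intro s t y z
      ext i
      refine Fin.cases ?_ (fun j => ?_) i <;> simp [A]
    have hRHS : ∫ y, Real.log (∫ z, g (fun i => a * y i + b * z i) ∂stdGn (n + 1)) ∂stdGn (n + 1) =
        ∫ y, ∫ s, Real.log (∫ t, U (a * s + b * t) y ∂stdG) ∂stdG ∂stdGn n := by
      rw [integral_stdGn_succ
        (F := fun y : Fin (n + 1) → ℝ =>
          Real.log (∫ z, g (fun i => a * y i + b * z i) ∂stdGn (n + 1)))
        (Real.measurable_log.comp
        (measurable_integral_right (stdGn (n + 1))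
          (F := fun y z : Fin (n + 1) → ℝ => g (fun i => a * y i + b * z i)) hA))
        fun y => log_mem_Icc hδ (integral_mem_Icc (hA.comp measurable_prodMk_left) fun z => hgm _)]
      have e : ∀ s y, ∫ z, g (fun i => a * (Fin.cons s y : Fin (n + 1) → ℝ) i + b * z i)
          ∂stdGn (n + 1) = ∫ t, U (a * s + b * t) y ∂stdG := by
        intro s y
        rw [integral_stdGn_succ
          (F := fun z => g (fun i => a * (Fin.cons s y : Fin (n + 1) → ℝ) i + b * z i))
          (hg.comp (by fun_prop)) fun z => hgm _]
        simp only [hcons]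
        rfl
      simp only [e]
      refine integral_integral_swap (f := fun s y => Real.log (∫ t, U (a * s + b * t) y ∂stdG)) ?_
      refine integrable_log_integral (α := ℝ × (Fin n → ℝ)) (stdG.prod (stdGn n)) stdG
        (F := fun p t => U (a * p.1 + b * t) p.2) ?_ hδ fun p t => Umem _ _
      exact Um.comp (f := fun q : (ℝ × (Fin n → ℝ)) × ℝ => (a * q.1.1 + b * q.2, q.1.2))
        (by fun_prop)
    have Upm : Measurable fun p : ℝ × (Fin n → ℝ) => U p.1 p.2 ^ (b ^ 2) := Um.pow_const _
    have Upm' : Measurable fun p : (Fin n → ℝ) × ℝ => U p.2 p.1 ^ (b ^ 2) :=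
      Upm.comp measurable_swap
    have Gpm : Measurable fun p : ℝ × (Fin n → ℝ) => G p.1 p.2 ^ (b ^ 2) := Gm.pow_const _
    -- The inequality on the line, in the first variable.
    have step1 : ∫ y, 1 / b ^ 2 * Real.log (∫ t, U t y ^ (b ^ 2) ∂stdG) ∂stdGn n ≤
        ∫ y, ∫ s, Real.log (∫ t, U (a * s + b * t) y ∂stdG) ∂stdG ∂stdGn n := by
      refine integral_mono ((integrable_log_integral (stdGn n) stdG
        (F := fun y t => U t y ^ (b ^ 2))
        Upm' hδp fun y t => hpow _ (Umem t y)).const_mul _) ?_ fun y =>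
        reverse_hyp_line hab hb hδ (Um.comp measurable_prodMk_right) fun t => Umem t y
      refine Integrable.integral_prod_left (μ := stdGn n) (ν := stdG)
        (f := fun p : (Fin n → ℝ) × ℝ => Real.log (∫ t, U (a * p.2 + b * t) p.1 ∂stdG)) ?_
      refine integrable_log_integral (α := (Fin n → ℝ) × ℝ) ((stdGn n).prod stdG) stdG
        (F := fun p t => U (a * p.2 + b * t) p.1) ?_ hδ fun p t => Umem _ _
      exact Um.comp (f := fun q : ((Fin n → ℝ) × ℝ) × ℝ => (a * q.1.2 + b * q.2, q.1.1))
        (by fun_prop)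
    have step2 := log_integral_exp_le stdG (stdGn n) (F := fun t y => U t y ^ (b ^ 2)) Upm hδp
      fun t y => hpow _ (Umem t y)
    -- The inequality in the remaining variables, for each value of the first.
    have step3 : ∫ x, g x ^ (b ^ 2) ∂stdGn (n + 1) ≤
        ∫ t, Real.exp (∫ y, Real.log (U t y ^ (b ^ 2)) ∂stdGn n) ∂stdG := by
      rw [integral_stdGn_succ (hg.pow_const _) fun x => hpow _ (hgm x)]
      have hin : ∀ t, ∫ x, g (Fin.cons t x) ^ (b ^ 2) ∂stdGn n ∈ Set.Icc (δ ^ (b ^ 2)) 1 := fun t =>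
        integral_mem_Icc (Gpm.comp measurable_prodMk_left) fun x => hpow _ (hgm _)
      have hlm : Measurable fun p : ℝ × (Fin n → ℝ) => Real.log (U p.1 p.2 ^ (b ^ 2)) :=
        Real.measurable_log.comp Upm
      refine integral_mono (integrable_of_mem_Icc (measurable_integral_right (stdGn n)
        (F := fun t x => g (Fin.cons t x) ^ (b ^ 2)) Gpm) hin)
        (integrable_of_mem_Icc (c := Real.exp (Real.log (δ ^ (b ^ 2)))) (C := Real.exp (Real.log 1))
          (Real.measurable_exp.comp (measurable_integral_right (stdGn n)
          (F := fun t y => Real.log (U t y ^ (b ^ 2))) hlm)) fun t => ?_) fun t => ?_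
      · have := integral_mem_Icc (μ := stdGn n) (hlm.comp measurable_prodMk_left)
          fun y => log_mem_Icc hδp (hpow _ (Umem t y))
        exact ⟨Real.exp_le_exp.2 this.1, Real.exp_le_exp.2 this.2⟩
      · have h1 := ih (g := G t) (Gm.comp measurable_prodMk_left) fun x => hgm _
        dsimp only
        rw [← Real.log_le_iff_le_exp (hδp.trans_le (hin t).1)]
        have e : ∀ y, Real.log (U t y ^ (b ^ 2)) = b ^ 2 * Real.log (U t y) := fun y =>
          Real.log_rpow (U0 t y) _
        simp only [e]
        rw [integral_const_mul]
        rw [one_div, ← div_eq_inv_mul, div_le_iff₀ hb2, mul_comm] at h1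
        exact h1
    have hpos : 0 < ∫ x, g x ^ (b ^ 2) ∂stdGn (n + 1) :=
      hδp.trans_le (integral_mem_Icc (hg.pow_const _) fun x => hpow _ (hgm x)).1
    rw [hRHS]
    refine le_trans ?_ step1
    rw [integral_const_mul]
    exact mul_le_mul_of_nonneg_left ((Real.log_le_log hpos step3).trans step2) (by positivity)

/-! ### Laws of centred Gaussian vectors -/

lemma charFunDual_map_of_centered {Ω ι : Type*} [MeasurableSpace Ω] [Fintype ι]
    [DecidableEq ι] {P : Measure Ω} {X : Ω → ι → ℝ} (hX : HasGaussianLaw X P)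
    (m : ∀ i, ∫ ω, X ω i ∂P = 0) (L : StrongDual ℝ (ι → ℝ)) :
    charFunDual (P.map X) L = Complex.exp (-((∑ i, ∑ j, L (Pi.single i 1) * L (Pi.single j 1) *
      ∫ ω, X ω i * X ω j ∂P : ℝ) : ℂ) / 2) := by
  have hP := hX.isProbabilityMeasure
  have hL : ∀ x, L x = ∑ i, L (Pi.single i 1) * x i := fun x => by
    conv_lhs => rw [← Finset.univ_sum_single x]
    rw [map_sum]
    refine Finset.sum_congr rfl fun i _ => ?_
    rw [show Pi.single i (x i) = x i • (Pi.single i 1 : ι → ℝ) by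
      rw [← Pi.single_smul, smul_eq_mul, mul_one], map_smul, smul_eq_mul, mul_comm]
  have l2 : ∀ i, MemLp (fun ω => X ω i) 2 P := fun i => (hX.eval i).memLp_two
  have hm : ∫ ω, L (X ω) ∂P = 0 := by
    rw [integral_congr_ae (Filter.Eventually.of_forall fun ω => hL (X ω))]
    rw [integral_finsetSum _ fun i _ => ((l2 i).integrable one_le_two).const_mul _]
    exact Finset.sum_eq_zero fun i _ => by rw [integral_const_mul, m, mul_zero]
  have hv : Var[fun ω => L (X ω); P] =
      ∑ i, ∑ j, L (Pi.single i 1) * L (Pi.single j 1) * ∫ ω, X ω i * X ω j ∂P := by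
    rw [variance_of_integral_eq_zero (hX.map_fun L).aemeasurable hm]
    have e : ∀ ω, L (X ω) ^ 2 =
        ∑ i, ∑ j, L (Pi.single i 1) * L (Pi.single j 1) * (X ω i * X ω j) := fun ω => by
      rw [hL, sq, Finset.sum_mul_sum]
      exact Finset.sum_congr rfl fun i _ => Finset.sum_congr rfl fun j _ => by ring
    have hi : ∀ i j, Integrable (fun ω => L (Pi.single i 1) * L (Pi.single j 1) *
        (X ω i * X ω j)) P := fun i j => ((l2 i).integrable_mul (l2 j)).const_mul _
    simp only [e]
    rw [integral_finsetSum _ fun i _ => integrable_finsetSum _ fun j _ => hi i j]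
    refine Finset.sum_congr rfl fun i _ => ?_
    rw [integral_finsetSum _ fun j _ => hi i j]
    exact Finset.sum_congr rfl fun j _ => integral_const_mul _ _
  rw [hX.charFunDual_map_eq_fun L, hm, hv]
  simp [neg_div]

/-- A centred Gaussian vector is determined in law by its second moments. -/
lemma map_eq_of_second_moments {Ω Ω' ι : Type*} [MeasurableSpace Ω] [MeasurableSpace Ω']
    [Fintype ι] {P : Measure Ω} {P' : Measure Ω'} {X : Ω → ι → ℝ} {X' : Ω' → ι → ℝ}
    (hX : HasGaussianLaw X P) (hX' : HasGaussianLaw X' P')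
    (m : ∀ i, ∫ ω, X ω i ∂P = 0) (m' : ∀ i, ∫ ω, X' ω i ∂P' = 0)
    (c : ∀ i j, ∫ ω, X ω i * X ω j ∂P = ∫ ω, X' ω i * X' ω j ∂P') :
    P.map X = P'.map X' := by
  classical
  have := hX.isGaussian_map
  have := hX'.isGaussian_map
  apply Measure.ext_of_charFunDual
  ext L
  rw [charFunDual_map_of_centered hX m, charFunDual_map_of_centered hX' m']
  simp only [c]

section StandardGaussian

variable {κ : Type*} [Fintype κ] {n : ℕ}

/-- The law of a finite family of independent standard Gaussian vectors in `ℝⁿ`. -/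
noncomputable abbrev stdGfam (κ : Type*) [Fintype κ] (n : ℕ) : Measure (κ → Fin n → ℝ) :=
  Measure.pi fun _ => stdGn n

lemma hasGaussianLaw_stdGfam : HasGaussianLaw (fun x : κ → Fin n → ℝ => x) (stdGfam κ n) := by
  have h1 : HasGaussianLaw (fun x : Fin n → ℝ => x) (stdGn n) :=
    iIndepFun.hasGaussianLaw (X := fun i (x : Fin n → ℝ) => x i)
      (fun i => ⟨by
        rw [(measurePreserving_eval (fun _ : Fin n => stdG) i).map_eq]; infer_instance⟩)
      (iIndepFun_pi (X := fun _ x => x) fun _ => aemeasurable_id)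
  refine iIndepFun.hasGaussianLaw (X := fun i (x : κ → Fin n → ℝ) => x i)
      (fun i => ⟨?_⟩) (iIndepFun_pi (X := fun _ x => x) fun _ => aemeasurable_id)
  rw [(measurePreserving_eval (fun _ : κ => stdGn n) i).map_eq]
  have := h1.isGaussian_map
  rwa [show (fun x : Fin n → ℝ => x) = id from rfl, Measure.map_id] at this

lemma integral_eval_stdGn (j : Fin n) : ∫ x, x j ∂stdGn n = 0 := by
  rw [integral_comp_eval (μ := fun _ : Fin n => stdG) (f := fun t => t) (by fun_prop)]
  simp

lemma integral_eval_stdGfam (c : κ) (j : Fin n) : ∫ x, x c j ∂stdGfam κ n = 0 := by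
  rw [integral_comp_eval (μ := fun _ : κ => stdGn n) (f := fun t => t j)
    (by fun_prop : Measurable _).aestronglyMeasurable, integral_eval_stdGn]

lemma integral_eval_mul_eval_stdGn (j k : Fin n) :
    ∫ x, x j * x k ∂stdGn n = if j = k then 1 else 0 := by
  split_ifs with h
  · subst h
    rw [integral_comp_eval (μ := fun _ : Fin n => stdG) (f := fun t => t * t) (by fun_prop)]
    have h1 : Var[fun x => x; stdG] = 1 := by simp [stdG]
    rw [variance_of_integral_eq_zero (by fun_prop) (by simp)] at h1
    simpa only [sq] using h1
  · have hi : iIndepFun (fun i (x : Fin n → ℝ) => x i) (stdGn n) :=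
      iIndepFun_pi (X := fun _ x => x) fun _ => aemeasurable_id
    rw [(hi.indepFun h).integral_fun_mul_eq_mul_integral
      (by fun_prop : Measurable _).aestronglyMeasurable
      (by fun_prop : Measurable _).aestronglyMeasurable,
      integral_eval_stdGn, zero_mul]

lemma integral_eval_mul_eval_stdGfam [DecidableEq κ] (c d : κ) (j k : Fin n) :
    ∫ x, x c j * x d k ∂stdGfam κ n = if c = d ∧ j = k then 1 else 0 := by
  by_cases h : c = d
  · subst h
    rw [integral_comp_eval (μ := fun _ : κ => stdGn n) (f := fun t => t j * t k)
      (by fun_prop : Measurable _).aestronglyMeasurable, integral_eval_mul_eval_stdGn]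
    simp
  · have hi : iIndepFun (fun i (x : κ → Fin n → ℝ) => x i) (stdGfam κ n) :=
      iIndepFun_pi (X := fun _ x => x) fun _ => aemeasurable_id
    have h2 : IndepFun (fun x : κ → Fin n → ℝ => x c j) (fun x => x d k) (stdGfam κ n) :=
      (hi.indepFun h).comp (measurable_pi_apply j) (measurable_pi_apply k)
    rw [h2.integral_fun_mul_eq_mul_integral (by fun_prop : Measurable _).aestronglyMeasurable
      (by fun_prop : Measurable _).aestronglyMeasurable, integral_eval_stdGfam, zero_mul, if_neg]
    exact fun h' => h h'.1

lemma hasGaussianLaw_linear {ι : Type*} [Fintype ι] (B : ι → κ → ℝ) (e : ι → Fin n) :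
    HasGaussianLaw (fun (x : κ → Fin n → ℝ) p => ∑ c, B p c * x c (e p)) (stdGfam κ n) := by
  let L : (κ → Fin n → ℝ) →L[ℝ] (ι → ℝ) := ContinuousLinearMap.pi fun p =>
    ∑ c, B p c • (ContinuousLinearMap.proj (R := ℝ) (φ := fun _ : Fin n => ℝ) (e p)).comp
      (ContinuousLinearMap.proj (R := ℝ) (φ := fun _ : κ => Fin n → ℝ) c)
  have hL : (fun (x : κ → Fin n → ℝ) p => ∑ c, B p c * x c (e p)) = fun x => L x := by
    ext x p
    simp [L]
  rw [hL]
  exact hasGaussianLaw_stdGfam.map_fun L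

lemma memLp_eval_stdGfam (c : κ) (j : Fin n) :
    MemLp (fun x : κ → Fin n → ℝ => x c j) 2 (stdGfam κ n) :=
  ((hasGaussianLaw_stdGfam.eval c).eval j).memLp_two

lemma integral_linear {ι : Type*} (B : ι → κ → ℝ) (e : ι → Fin n) (p : ι) :
    ∫ x, ∑ c, B p c * x c (e p) ∂stdGfam κ n = 0 := by
  rw [integral_finsetSum _ fun c _ =>
    ((memLp_eval_stdGfam c (e p)).integrable one_le_two).const_mul _]
  simp [integral_const_mul, integral_eval_stdGfam]

lemma integral_linear_mul_linear {ι : Type*} (B : ι → κ → ℝ) (e : ι → Fin n) (p q : ι) :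
    ∫ x, (∑ c, B p c * x c (e p)) * (∑ c, B q c * x c (e q)) ∂stdGfam κ n =
      if e p = e q then ∑ c, B p c * B q c else 0 := by
  classical
  have h : ∀ x : κ → Fin n → ℝ, (∑ c, B p c * x c (e p)) * (∑ c, B q c * x c (e q)) =
      ∑ c, ∑ d, B p c * B q d * (x c (e p) * x d (e q)) := fun x => by
    rw [Finset.sum_mul_sum]
    exact Finset.sum_congr rfl fun c _ => Finset.sum_congr rfl fun d _ => by ring
  have hi : ∀ c d, Integrable (fun x : κ → Fin n → ℝ => B p c * B q d *
      (x c (e p) * x d (e q))) (stdGfam κ n) := fun c d =>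
    ((memLp_eval_stdGfam c _).integrable_mul (memLp_eval_stdGfam d _)).const_mul _
  simp only [h]
  rw [integral_finsetSum _ fun c _ => integrable_finsetSum _ fun d _ => hi c d]
  have h2 : ∀ c, ∫ x, ∑ d, B p c * B q d * (x c (e p) * x d (e q)) ∂stdGfam κ n =
      ∑ d, B p c * B q d * if c = d ∧ e p = e q then 1 else 0 := fun c => by
    rw [integral_finsetSum _ fun d _ => hi c d]
    exact Finset.sum_congr rfl fun d _ => by
      rw [integral_const_mul, integral_eval_mul_eval_stdGfam]
  simp only [h2]
  split_ifs with he <;> simp [he]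

end StandardGaussian

section Sample

variable {Ω : Type*} [MeasurableSpace Ω] {P : Measure Ω} {n : ℕ}
  {C : Fin 3 → Fin 3 → ℝ} {N : Fin n → Ω → Fin 3 → ℝ}

lemma IsGaussianSample.hasGaussianLaw (hN : IsGaussianSample P C N) :
    HasGaussianLaw (fun ω (p : Fin n × Fin 3) => N p.1 ω p.2) P := by
  let L : (Fin n → Fin 3 → ℝ) →L[ℝ] (Fin n × Fin 3 → ℝ) := ContinuousLinearMap.pi fun p =>
    (ContinuousLinearMap.proj (R := ℝ) (φ := fun _ : Fin 3 => ℝ) p.2).comp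
      (ContinuousLinearMap.proj (R := ℝ) (φ := fun _ : Fin n => Fin 3 → ℝ) p.1)
  exact (hN.indep.hasGaussianLaw hN.gaussian).map_fun L

lemma IsGaussianSample.integral_mul (hN : IsGaussianSample P C N) (j k : Fin n) (a b : Fin 3) :
    ∫ ω, N j ω a * N k ω b ∂P = if j = k then C a b else 0 := by
  split_ifs with h
  · subst h; exact hN.cov j a b
  · have h2 : IndepFun (fun ω => N j ω a) (fun ω => N k ω b) P :=
      (hN.indep.indepFun h).comp (measurable_pi_apply a) (measurable_pi_apply b)
    rw [h2.integral_fun_mul_eq_mul_integral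
      ((hN.gaussian j).eval a).aemeasurable.aestronglyMeasurable
      ((hN.gaussian k).eval b).aemeasurable.aestronglyMeasurable, hN.mean, zero_mul]

/-- If `C = B Bᵀ`, a Gaussian sample with covariance `C` has the law of `B` applied to independent
standard Gaussian vectors indexed by `κ`. -/
lemma IsGaussianSample.map_eq_linear (hN : IsGaussianSample P C N) {κ : Type*} [Fintype κ]
    (B : Fin 3 → κ → ℝ) (hB : ∀ a b, C a b = ∑ c, B a c * B b c) :
    P.map (fun ω (p : Fin n × Fin 3) => N p.1 ω p.2) =
      (stdGfam κ n).map fun x p => ∑ c, B p.2 c * x c p.1 := by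
  refine map_eq_of_second_moments hN.hasGaussianLaw
    (hasGaussianLaw_linear (fun p : Fin n × Fin 3 => B p.2) Prod.fst)
    (fun p => hN.mean _ _) (integral_linear (fun p : Fin n × Fin 3 => B p.2) Prod.fst) fun p q => ?_
  rw [hN.integral_mul,
    integral_linear_mul_linear (fun p : Fin n × Fin 3 => B p.2) Prod.fst p q, hB]

end Sample

/-- A normalised combination of independent standard Gaussian vectors is `s` times a standard
Gaussian vector. -/
lemma map_linear_stdGfam {κ : Type*} [Fintype κ] {n : ℕ} (v : κ → ℝ) (s : ℝ)
    (hv : ∑ c, v c * v c = s ^ 2) :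
    (stdGfam κ n).map (fun x j => ∑ c, v c * x c j) = (stdGn n).map (fun y j => s * y j) := by
  have h1 := map_eq_of_second_moments
    (hasGaussianLaw_linear (fun _ : Fin n => v) id)
    (hasGaussianLaw_linear (κ := Unit) (fun _ : Fin n => fun _ => s) id)
    (integral_linear (fun _ : Fin n => v) id)
    (integral_linear (κ := Unit) (fun _ : Fin n => fun _ => s) id) (fun p q => by
      rw [integral_linear_mul_linear (fun _ : Fin n => v) id p q,
        integral_linear_mul_linear (κ := Unit) (fun _ : Fin n => fun _ => s) id p q]
      simp [hv, sq])
  simp only [id] at h1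
  rw [h1, ← (measurePreserving_eval (fun _ : Unit => stdGn n) ()).map_eq,
    Measure.map_map (by fun_prop) (by fun_prop)]
  congr 1
  ext x j
  simp

/-! ### Three correlated Gaussian vectors -/

section Core

variable {Ω : Type*} [MeasurableSpace Ω] {P : Measure Ω} {n : ℕ}
  {C : Fin 3 → Fin 3 → ℝ} {N : Fin n → Ω → Fin 3 → ℝ}

lemma IsGaussianSample.integral_comp (hN : IsGaussianSample P C N) {κ : Type*} [Fintype κ]
    (B : Fin 3 → κ → ℝ) (hB : ∀ a b, C a b = ∑ c, B a c * B b c)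
    {F : (Fin 3 → Fin n → ℝ) → ℝ} (hF : Measurable F) :
    ∫ ω, F (fun i => coordVec N i ω) ∂P =
      ∫ x, F (fun i j => ∑ c, B i c * x c j) ∂stdGfam κ n := by
  have hF' : Measurable fun y : Fin n × Fin 3 → ℝ => F fun i j => y (j, i) :=
    hF.comp (by fun_prop)
  have h := congrArg (fun μ => ∫ y, F (fun i j => y (j, i)) ∂μ) (hN.map_eq_linear B hB)
  rw [integral_map hN.hasGaussianLaw.aemeasurable hF'.aestronglyMeasurable,
    integral_map (by fun_prop : Measurable _).aemeasurable hF'.aestronglyMeasurable] at h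
  exact h

/-- Each `𝒩_i` is a standard Gaussian vector. The factorization `C = B Bᵀ` serves only the proof. -/
lemma IsGaussianSample.integral_coordVec (hN : IsGaussianSample P C N) {κ : Type*} [Fintype κ]
    (B : Fin 3 → κ → ℝ) (hB : ∀ a b, C a b = ∑ c, B a c * B b c) {i : Fin 3} (hC : C i i = 1)
    {g : (Fin n → ℝ) → ℝ} (hg : Measurable g) :
    ∫ ω, g (coordVec N i ω) ∂P = ∫ x, g x ∂stdGn n := by
  rw [hN.integral_comp B hB (F := fun y => g (y i)) (by fun_prop)]
  have h := congrArg (fun μ => ∫ y, g y ∂μ) (map_linear_stdGfam (n := n) (B i) 1 (by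
    rw [← hB, hC, one_pow]))
  rw [integral_map (by fun_prop : Measurable _).aemeasurable hg.aestronglyMeasurable,
    integral_map (by fun_prop : Measurable _).aemeasurable hg.aestronglyMeasurable] at h
  simpa only [one_mul] using h

/-- `prod_rpow_le` for functions bounded away from zero. -/
lemma prod_rpow_le_of_pos {a b : ℝ} (hab : a ^ 2 + b ^ 2 = 1) (hb : 0 < b)
    (A : Fin 3 → Fin 3 → ℝ) (hA : ∀ i j, C i j = (if i = j then b ^ 2 else 0) + ∑ c, A i c * A j c)
    (hC : ∀ i, C i i = 1) (hN : IsGaussianSample P C N) {δ : ℝ} (hδ : 0 < δ)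
    {g : Fin 3 → (Fin n → ℝ) → ℝ} (hg : ∀ i, Measurable (g i))
    (hgm : ∀ i x, g i x ∈ Set.Icc δ 1) :
    ∏ i, (∫ ω, g i (coordVec N i ω) ∂P) ^ (1 / b ^ 2) ≤
      ∫ ω, ∏ i, g i (coordVec N i ω) ∂P := by
  have hb2 : 0 < b ^ 2 := by positivity
  -- `C = B Bᵀ` for the block matrix `B = (b I | A)`.
  let B : Fin 3 → Fin 3 ⊕ Fin 3 → ℝ := fun i => Sum.elim (fun c => if i = c then b else 0) (A i)
  have hB : ∀ i j, C i j = ∑ c, B i c * B j c := fun i j => by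
    rw [hA, Fintype.sum_sum_type]
    simp only [B, Sum.elim_inl, Sum.elim_inr]
    congr 1
    by_cases h : i = j
    · simp [h, sq]
    · simp [h]
  let Y : (Fin 3 → Fin n → ℝ) → Fin 3 → Fin n → ℝ := fun ξ i j => ∑ c, A i c * ξ c j
  have Ym : ∀ i, Measurable fun ξ => Y ξ i := fun i => by simp only [Y]; fun_prop
  let h : Fin 3 → (Fin n → ℝ) → ℝ := fun i y => ∫ z, g i (fun j => y j + b * z j) ∂stdGn n
  have gm2 : ∀ i, Measurable fun p : (Fin n → ℝ) × (Fin n → ℝ) =>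
      g i (fun j => p.1 j + b * p.2 j) :=
    fun i => (hg i).comp (by fun_prop)
  have hm : ∀ i, Measurable (h i) := fun i =>
    measurable_integral_right (stdGn n)
      (F := fun y z : Fin n → ℝ => g i (fun j => y j + b * z j)) (gm2 i)
  have hmem : ∀ i y, h i y ∈ Set.Icc δ 1 := fun i y =>
    integral_mem_Icc ((gm2 i).comp measurable_prodMk_left) fun z => hgm i _
  have h0 : ∀ i y, 0 < h i y := fun i y => hδ.trans_le (hmem i y).1
  have prod_mem : ∀ t : Fin 3 → ℝ, (∀ i, t i ∈ Set.Icc δ 1) → ∏ i, t i ∈ Set.Icc 0 1 := fun t ht =>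
    ⟨Finset.prod_nonneg fun i _ => hδ.le.trans (ht i).1,
      Finset.prod_le_one (fun i _ => hδ.le.trans (ht i).1) fun i _ => (ht i).2⟩
  have hjoint : ∫ ω, ∏ i, g i (coordVec N i ω) ∂P =
      ∫ ξ, ∏ i, h i (Y ξ i) ∂stdGfam (Fin 3) n := by
    rw [hN.integral_comp B hB (F := fun y => ∏ i, g i (y i)) (by fun_prop)]
    have hmp := measurePreserving_sumPiEquivProdPi_symm
      (X := fun _ : Fin 3 ⊕ Fin 3 => Fin n → ℝ) fun _ => stdGn n
    rw [← hmp.integral_comp']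
    have e : ∀ (p : (Fin 3 → Fin n → ℝ) × (Fin 3 → Fin n → ℝ)) (i : Fin 3) (j : Fin n),
        ∑ c, B i c * (MeasurableEquiv.sumPiEquivProdPi
          (fun _ : Fin 3 ⊕ Fin 3 => Fin n → ℝ)).symm p c j = Y p.2 i j + b * p.1 i j := by
      intro p i j
      rw [Fintype.sum_sum_type, add_comm]
      congr 1
      change ∑ c, (if i = c then b else 0) * p.1 c j = _
      simp
    simp only [e]
    have hmeas : Measurable fun p : (Fin 3 → Fin n → ℝ) × (Fin 3 → Fin n → ℝ) =>
        ∏ i, g i fun j => Y p.2 i j + b * p.1 i j :=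
      Finset.measurable_prod _ fun i _ => (gm2 i).comp
        (((Ym i).comp measurable_snd).prodMk (by fun_prop))
    rw [integral_prod_symm _ (integrable_of_mem_Icc hmeas fun p => prod_mem _ fun i => hgm i _)]
    congr 1
    ext ξ
    exact integral_fintype_prod_eq_prod (μ := fun _ : Fin 3 => stdGn n)
      fun i z => g i fun j => Y ξ i j + b * z j
  have hlog : ∀ i, ∫ ξ, Real.log (h i (Y ξ i)) ∂stdGfam (Fin 3) n =
      ∫ y, Real.log (∫ z, g i (fun j => a * y j + b * z j) ∂stdGn n) ∂stdGn n := by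
    intro i
    have hs : ∑ c, A i c * A i c = a ^ 2 := by
      have := hA i i
      rw [hC, if_pos rfl] at this
      linarith
    have hl : Measurable fun y => Real.log (h i y) := Real.measurable_log.comp (hm i)
    have e := congrArg (fun μ => ∫ y, Real.log (h i y) ∂μ) (map_linear_stdGfam (n := n) (A i) a hs)
    rwa [integral_map (by fun_prop : Measurable _).aemeasurable hl.aestronglyMeasurable,
      integral_map (by fun_prop : Measurable _).aemeasurable hl.aestronglyMeasurable] at e
  have hli : ∀ i, Integrable (fun ξ => Real.log (h i (Y ξ i))) (stdGfam (Fin 3) n) := fun i =>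
    integrable_of_mem_Icc (Real.measurable_log.comp ((hm i).comp (Ym i))) fun ξ =>
      log_mem_Icc hδ (hmem i _)
  -- Jensen's inequality removes the dependence between the three vectors `Y ξ i`.
  have hJ := exp_jensen (μ := stdGfam (Fin 3) n) (L := fun ξ => ∑ i, Real.log (h i (Y ξ i)))
    (integrable_finsetSum _ fun i _ => hli i) (by
      simp only [Real.exp_sum, Real.exp_log (h0 _ _)]
      exact integrable_of_mem_Icc (Finset.measurable_prod _ fun i _ => (hm i).comp (Ym i))
        fun ξ => prod_mem _ fun i => hmem i _)
  simp only [Real.exp_sum, Real.exp_log (h0 _ _)] at hJ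
  rw [← hjoint, integral_finsetSum _ fun i _ => hli i] at hJ
  have hE : ∀ i, 0 < ∫ x, g i x ∂stdGn n := fun i =>
    hδ.trans_le (integral_mem_Icc (hg i) (hgm i)).1
  have hi : ∀ i, Real.log ((∫ ω, g i (coordVec N i ω) ∂P) ^ (1 / b ^ 2)) ≤
      ∫ ξ, Real.log (h i (Y ξ i)) ∂stdGfam (Fin 3) n := by
    intro i
    rw [hN.integral_coordVec B hB (hC i) (hg i), Real.log_rpow (hE i), hlog]
    refine le_trans ?_ (reverse_hyp hab hb hδ n (hg i) (hgm i))
    refine mul_le_mul_of_nonneg_left (Real.log_le_log (hE i) ?_) (by positivity)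
    have hpm : ∀ x, g i x ^ (b ^ 2) ∈ Set.Icc 0 1 := fun x =>
      have h1 := hδ.le.trans (hgm i x).1
      ⟨Real.rpow_nonneg h1 _, Real.rpow_le_one h1 (hgm i x).2 hb2.le⟩
    refine integral_mono (integrable_of_mem_Icc (hg i) (hgm i))
      (integrable_of_mem_Icc ((hg i).pow_const _) hpm) fun x => ?_
    -- `g ≤ g ^ b ^ 2` for values in `[0, 1]`.
    have := Real.rpow_le_rpow_of_exponent_ge (hδ.trans_le (hgm i x).1) (hgm i x).2
      (show b ^ 2 ≤ 1 by nlinarith [sq_nonneg a])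
    rwa [Real.rpow_one] at this
  have hpos : ∀ i, 0 < (∫ ω, g i (coordVec N i ω) ∂P) ^ (1 / b ^ 2) := fun i => by
    rw [hN.integral_coordVec B hB (hC i) (hg i)]
    exact Real.rpow_pos_of_pos (hE i) _
  have hfin := (Finset.sum_le_sum fun i (_ : i ∈ Finset.univ) => hi i).trans hJ
  rw [← Real.log_prod fun i _ => (hpos i).ne'] at hfin
  refine (Real.log_le_log_iff (Finset.prod_pos fun i _ => hpos i) ?_).1 hfin
  rw [hjoint]
  have : ∀ ξ, ∏ i, h i (Y ξ i) ∈ Set.Icc (∏ _i : Fin 3, δ) 1 := fun ξ =>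
    ⟨Finset.prod_le_prod (fun _ _ => hδ.le) fun i _ => (hmem i _).1,
      (prod_mem _ fun i => hmem i _).2⟩
  exact (Finset.prod_pos fun _ _ => hδ).trans_le (integral_mem_Icc
    (Finset.measurable_prod _ fun i _ => (hm i).comp (Ym i)) this).1

lemma IsGaussianSample.aemeasurable_coordVec (hN : IsGaussianSample P C N) (i : Fin 3) :
    AEMeasurable (coordVec N i) P :=
  (by fun_prop : Measurable fun (y : Fin n × Fin 3 → ℝ) (j : Fin n) => y (j, i)).comp_aemeasurable
    hN.hasGaussianLaw.aemeasurable

lemma IsGaussianSample.integrable_comp [IsProbabilityMeasure P] (hN : IsGaussianSample P C N)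
    (i : Fin 3) {g : (Fin n → ℝ) → ℝ} (hg : Measurable g) {c d : ℝ} (h : ∀ x, g x ∈ Set.Icc c d) :
    Integrable (fun ω => g (coordVec N i ω)) P :=
  Integrable.of_mem_Icc c d (hg.comp_aemeasurable (hN.aemeasurable_coordVec i))
    (Filter.Eventually.of_forall fun _ => h _)

/-- Reverse hypercontractivity for three correlated Gaussian vectors. The hypothesis `hA` says that
`C - b ^ 2 I` is positive semidefinite, in the form of a factorization `A Aᵀ`. -/
theorem prod_rpow_le [IsProbabilityMeasure P] {a b : ℝ} (hab : a ^ 2 + b ^ 2 = 1) (hb : 0 < b)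
    (A : Fin 3 → Fin 3 → ℝ) (hA : ∀ i j, C i j = (if i = j then b ^ 2 else 0) + ∑ c, A i c * A j c)
    (hC : ∀ i, C i i = 1) (hN : IsGaussianSample P C N)
    {g : Fin 3 → (Fin n → ℝ) → ℝ} (hg : ∀ i, Measurable (g i))
    (hgm : ∀ i x, g i x ∈ Set.Icc (0 : ℝ) 1) :
    ∏ i, (∫ ω, g i (coordVec N i ω) ∂P) ^ (1 / b ^ 2) ≤
      ∫ ω, ∏ i, g i (coordVec N i ω) ∂P := by
  let G : ℕ → Fin 3 → (Fin n → ℝ) → ℝ := fun k i x => max (g i x) (1 / (k + 1 : ℝ))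
  have hk : ∀ k : ℕ, (0 : ℝ) < 1 / (k + 1 : ℝ) := fun k => by positivity
  have hk1 : ∀ k : ℕ, 1 / (k + 1 : ℝ) ≤ 1 := fun k => by
    rw [div_le_one (by positivity)]
    linarith [(Nat.cast_nonneg k : (0 : ℝ) ≤ k)]
  have hGm : ∀ k i, Measurable (G k i) := fun k i => (hg i).max measurable_const
  have hG : ∀ (k : ℕ) i x, G k i x ∈ Set.Icc (1 / (k + 1 : ℝ)) 1 := fun k i x =>
    ⟨le_max_right _ _, max_le (hgm i x).2 (hk1 k)⟩
  have hlim : Filter.Tendsto (fun k : ℕ => ∫ ω, ∏ i, G k i (coordVec N i ω) ∂P) Filter.atTop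
      (nhds (∫ ω, ∏ i, g i (coordVec N i ω) ∂P)) := by
    refine tendsto_integral_of_dominated_convergence (fun _ => 1)
      (fun k => (Finset.aemeasurable_fun_prod _ fun i _ => (hGm k i).comp_aemeasurable
        (hN.aemeasurable_coordVec i)).aestronglyMeasurable) (integrable_const _)
      (fun k => Filter.Eventually.of_forall fun ω => ?_)
      (Filter.Eventually.of_forall fun ω => tendsto_finsetProd _ fun i _ => ?_)
    · have h0 : ∀ i, 0 ≤ G k i (coordVec N i ω) := fun i => (hk k).le.trans (hG k i _).1
      rw [Real.norm_of_nonneg (Finset.prod_nonneg fun i _ => h0 i)]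
      exact Finset.prod_le_one (fun i _ => h0 i) fun i _ => (hG k i _).2
    · have := (tendsto_const_nhds (x := g i (coordVec N i ω))).max
        (tendsto_one_div_add_atTop_nhds_zero_nat (𝕜 := ℝ))
      rwa [max_eq_left (hgm i _).1] at this
  refine ge_of_tendsto' hlim fun k => le_trans ?_
    (prod_rpow_le_of_pos hab hb A hA hC hN (hk k) (hGm k) (hG k))
  have h0 : ∀ i, 0 ≤ ∫ ω, g i (coordVec N i ω) ∂P := fun i =>
    integral_nonneg fun ω => (hgm i _).1
  refine Finset.prod_le_prod (fun i _ => Real.rpow_nonneg (h0 i) _) fun i _ =>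
    Real.rpow_le_rpow (h0 i) ?_ (by positivity)
  exact integral_mono (hN.integrable_comp i (hg i) (hgm i))
    (hN.integrable_comp i (hGm k i) (hG k i)) fun ω => le_max_left _ _

end Core

/-! ### Covariance matrices -/

section Factor
open scoped MatrixOrder Matrix.Norms.L2Operator

/-- A symmetric matrix `C` with `C ≥ r I` is `r I + A Aᵀ` for some `A`. -/
lemma exists_factor {C : Fin 3 → Fin 3 → ℝ} (hs : ∀ i j, C i j = C j i) {r : ℝ}
    (h : ∀ x : Fin 3 → ℝ, r * ∑ i, x i ^ 2 ≤ ∑ i, ∑ j, x i * x j * C i j) :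
    ∃ A : Fin 3 → Fin 3 → ℝ, ∀ i j, C i j = (if i = j then r else 0) + ∑ c, A i c * A j c := by
  let M : Matrix (Fin 3) (Fin 3) ℝ := Matrix.of C - r • 1
  have hM : M.PosSemidef := by
    refine Matrix.PosSemidef.of_dotProduct_mulVec_nonneg ?_ fun x => ?_
    · ext i j
      simp [M, Matrix.one_apply, hs i j, eq_comm]
    · have := h x
      simp only [M, Fin.sum_univ_three, dotProduct, Matrix.mulVec, Matrix.sub_apply,
        Matrix.smul_apply, Matrix.of_apply, Matrix.one_apply, star_trivial, smul_eq_mul] at this ⊢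
      simp
      linarith
  obtain ⟨X, hX⟩ := CStarAlgebra.nonneg_iff_eq_star_mul_self.mp hM.nonneg
  refine ⟨fun i c => X c i, fun i j => ?_⟩
  have h1 := congrFun (congrFun hX i) j
  simp only [M, Matrix.sub_apply, Matrix.of_apply, Matrix.smul_apply, Matrix.one_apply,
    Matrix.star_eq_conjTranspose, Matrix.mul_apply, Matrix.conjTranspose_apply, star_trivial,
    smul_eq_mul, mul_ite, mul_one, mul_zero] at h1
  linarith

end Factor

lemma uniformCov_coercive (x : Fin 3 → ℝ) :
    1 / 3 * ∑ i, x i ^ 2 ≤ ∑ i, ∑ j, x i * x j * uniformCov i j := by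
  simp only [Fin.sum_univ_three, uniformCov]
  simp
  nlinarith [sq_nonneg (x 0 - x 1), sq_nonneg (x 1 - x 2), sq_nonneg (x 2 - x 0)]

lemma sum_pref_mul_pref (i j : Fin 3) :
    ∑ σ, pref i σ * pref j σ = if i = j then 6 else -2 := by
  have h : ∀ i j : Fin 3, ∑ σ : Equiv.Perm (Fin 3), (if σ i < σ (i + 1) then (1 : ℤ) else -1) *
      (if σ j < σ (j + 1) then (1 : ℤ) else -1) = if i = j then 6 else -2 := by decide
  have h' := congrArg (Int.cast : ℤ → ℝ) (h i j)
  push_cast at h'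
  exact h'

/-- The quadratic form of `voteCov μ` is `E (∑ x_i pref_i) ^ 2`. Replacing every atom by the
smallest one leaves `α` times the sum over all rankings, which is
`8 |x| ^ 2 - 2 (∑ x_i) ^ 2 ≥ 2 |x| ^ 2`. -/
lemma voteCov_coercive (μ : PMF (Equiv.Perm (Fin 3))) (x : Fin 3 → ℝ) :
    2 * minAtom μ * ∑ i, x i ^ 2 ≤ ∑ i, ∑ j, x i * x j * voteCov μ i j := by
  have h1 : ∑ i, ∑ j, x i * x j * voteCov μ i j =
      ∑ σ, (μ σ).toReal * (∑ i, x i * pref i σ) ^ 2 := by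
    simp only [voteCov, Finset.mul_sum]
    rw [Finset.sum_congr rfl fun i _ => Finset.sum_comm, Finset.sum_comm]
    refine Finset.sum_congr rfl fun σ _ => ?_
    simp only [Fin.sum_univ_three]
    ring
  have h2 : ∑ σ, (∑ i, x i * pref i σ) ^ 2 = 8 * ∑ i, x i ^ 2 - 2 * (∑ i, x i) ^ 2 := by
    have : ∀ σ, (∑ i, x i * pref i σ) ^ 2 =
        ∑ i, ∑ j, x i * x j * (pref i σ * pref j σ) := fun σ => by
      simp only [Fin.sum_univ_three]
      ring
    simp only [this]
    rw [Finset.sum_comm, Finset.sum_congr rfl fun i _ => Finset.sum_comm]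
    simp only [← Finset.mul_sum, sum_pref_mul_pref]
    simp only [Fin.sum_univ_three]
    simp
    ring
  have hmin : ∀ σ, minAtom μ ≤ (μ σ).toReal := fun σ => ciInf_le (Set.finite_range _).bddBelow σ
  have h0 : 0 ≤ minAtom μ := Real.iInf_nonneg fun σ => ENNReal.toReal_nonneg
  have h3 : minAtom μ * ∑ σ, (∑ i, x i * pref i σ) ^ 2 ≤
      ∑ σ, (μ σ).toReal * (∑ i, x i * pref i σ) ^ 2 := by
    rw [Finset.mul_sum]
    exact Finset.sum_le_sum fun σ _ => mul_le_mul_of_nonneg_right (hmin σ) (sq_nonneg _)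
  rw [h1]
  refine le_trans ?_ h3
  rw [h2, mul_comm 2, mul_assoc]
  refine mul_le_mul_of_nonneg_left ?_ h0
  simp only [Fin.sum_univ_three]
  nlinarith [sq_nonneg (x 0 - x 1), sq_nonneg (x 1 - x 2), sq_nonneg (x 2 - x 0)]

lemma voteCov_self (μ : PMF (Equiv.Perm (Fin 3))) (i : Fin 3) : voteCov μ i i = 1 := by
  have h : ∀ σ, pref i σ * pref i σ = 1 := fun σ => by
    unfold pref
    split_ifs <;> norm_num
  simp only [voteCov, h, mul_one]
  have h1 := μ.tsum_coe
  rw [tsum_fintype] at h1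
  rw [← ENNReal.toReal_sum fun σ _ => μ.apply_ne_top σ, h1, ENNReal.toReal_one]

/-! ### The paradox probability -/

lemma measureReal_eq_integral_indicator {Ω : Type*} [MeasurableSpace Ω] {P : Measure Ω} {S : Set Ω}
    (hS : NullMeasurableSet S P) : P.real S = ∫ ω, S.indicator (fun _ => (1 : ℝ)) ω ∂P := by
  rw [integral_indicator₀ hS]
  simp

section Paradox

variable {Ω : Type*} [MeasurableSpace Ω] {P : Measure Ω} [IsProbabilityMeasure P] {n : ℕ}
  {C : Fin 3 → Fin 3 → ℝ} {N : Fin n → Ω → Fin 3 → ℝ}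

/-- `s` is the sum of the probabilities that three independent `±1`-valued variables with means
`x, y, z` are all equal to `1`, respectively to `-1`; each of the two is a lower bound. -/
lemma prod_le_s {u : ℝ} (hu : u = -1 ∨ u = 1) {x y z : ℝ} (hx : x ∈ Set.Icc (-1 : ℝ) 1)
    (hy : y ∈ Set.Icc (-1 : ℝ) 1) (hz : z ∈ Set.Icc (-1 : ℝ) 1) :
    (1 + u * x) / 2 * ((1 + u * y) / 2) * ((1 + u * z) / 2) ≤ s x y z := by
  have h : s x y z = (1 + u * x) / 2 * ((1 + u * y) / 2) * ((1 + u * z) / 2) +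
      (1 - u * x) / 2 * ((1 - u * y) / 2) * ((1 - u * z) / 2) := by
    rcases hu with rfl | rfl <;> simp only [s] <;> ring
  have hn : ∀ t ∈ Set.Icc (-1 : ℝ) 1, 0 ≤ (1 - u * t) / 2 := fun t ht => by
    rcases hu with rfl | rfl <;> linarith [ht.1, ht.2]
  have := mul_nonneg (mul_nonneg (hn x hx) (hn y hy)) (hn z hz)
  linarith

/-- If no `m i` is close to a sign `u` while a neighbour is close to `-u`, then for one of the signs
`u` no `u * m i` is close to `-1`. Any two indices modulo `3` are equal or neighbours. -/
lemma exists_common_sign {m : Fin 3 → ℝ} {ε : ℝ} (hε : ε ≤ 1)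
    (h : ∀ i : Fin 3, ∀ u ∈ ({-1, 1} : Set ℝ), min (u * m i) (-u * m (i + 1)) ≤ 1 - ε) :
    ∃ u : ℝ, (u = -1 ∨ u = 1) ∧ ∀ i, ε - 1 ≤ u * m i := by
  by_contra! hc
  obtain ⟨i, hi⟩ := hc 1 (Or.inr rfl)
  obtain ⟨j, hj⟩ := hc (-1) (Or.inl rfl)
  have hij : ∀ i j : Fin 3, j = i ∨ j = i + 1 ∨ i = j + 1 := by decide
  rcases hij i j with rfl | rfl | rfl
  · linarith
  · have := h i (-1) (by simp)
    rcases min_le_iff.1 this with h1 | h1 <;> linarith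
  · have := h j 1 (by simp)
    rcases min_le_iff.1 this with h1 | h1 <;> linarith

/-- The paradox bound for every covariance matrix `C ≥ r I` with unit diagonal. -/
lemma rpow_le_paradox {r : ℝ} (hr : 0 < r) (hs : ∀ i j, C i j = C j i) (hC : ∀ i, C i i = 1)
    (hpd : ∀ x : Fin 3 → ℝ, r * ∑ i, x i ^ 2 ≤ ∑ i, ∑ j, x i * x j * C i j)
    (hN : IsGaussianSample P C N) {ε : ℝ} (hε : 0 < ε) (hε1 : ε ≤ 1)
    {f : Fin 3 → (Fin n → ℝ) → ℝ} (hf : ∀ i, Measurable (f i))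
    (hfm : ∀ i x, f i x ∈ Set.Icc (-1 : ℝ) 1)
    (h : ∀ i : Fin 3, ∀ u ∈ ({-1, 1} : Set ℝ), min (u * ∫ ω, f i (coordVec N i ω) ∂P)
      (-u * ∫ ω, f (i + 1) (coordVec N (i + 1) ω) ∂P) ≤ 1 - ε) :
    (ε / 2) ^ (3 / r) ≤ paradox P N f := by
  -- The unit diagonal bounds `r`.
  have hr1 : r ≤ 1 := by
    have := hpd (Pi.single 0 1)
    simpa [Fin.sum_univ_three, hC] using this
  obtain ⟨A, hA⟩ := exists_factor hs hpd
  have hb2 : Real.sqrt r ^ 2 = r := Real.sq_sqrt hr.le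
  obtain ⟨u, hu, hum⟩ := exists_common_sign (m := fun i => ∫ ω, f i (coordVec N i ω) ∂P) hε1 h
  let g : Fin 3 → (Fin n → ℝ) → ℝ := fun i x => (1 + u * f i x) / 2
  have hg : ∀ i, Measurable (g i) := fun i => by
    have := hf i
    simp only [g]
    fun_prop
  have hgm : ∀ i x, g i x ∈ Set.Icc (0 : ℝ) 1 := fun i x => by
    have := hfm i x
    simp only [g]
    rcases hu with rfl | rfl <;> constructor <;> linarith [this.1, this.2]
  have hE : ∀ i, ε / 2 ≤ ∫ ω, g i (coordVec N i ω) ∂P := fun i => by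
    simp only [g]
    rw [integral_div, integral_add (integrable_const _)
      ((hN.integrable_comp i (hf i) (hfm i)).const_mul u), integral_const_mul]
    simp only [integral_const, probReal_univ, smul_eq_mul, mul_one]
    linarith [hum i]
  have hmain := prod_rpow_le (a := Real.sqrt (1 - r)) (b := Real.sqrt r)
    (by rw [hb2, Real.sq_sqrt (by linarith)]; ring) (Real.sqrt_pos.2 hr) A
    (by simpa only [hb2] using hA) hC hN hg hgm
  rw [hb2] at hmain
  have hlow : (ε / 2) ^ (3 / r) ≤ ∏ i, (∫ ω, g i (coordVec N i ω) ∂P) ^ (1 / r) := by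
    have e : (ε / 2) ^ (3 / r) = ∏ _i : Fin 3, (ε / 2) ^ (1 / r) := by
      rw [Finset.prod_const, Finset.card_fin, ← Real.rpow_mul_natCast (by positivity)]
      congr 1
      push_cast
      ring
    rw [e]
    exact Finset.prod_le_prod (fun i _ => by positivity) fun i _ =>
      Real.rpow_le_rpow (by positivity) (hE i) (by positivity)
  refine (hlow.trans hmain).trans ?_
  have hfc : ∀ i, AEMeasurable (fun ω => f i (coordVec N i ω)) P := fun i =>
    (hf i).comp_aemeasurable (hN.aemeasurable_coordVec i)
  have hgc : ∀ i, AEMeasurable (fun ω => g i (coordVec N i ω)) P := fun i =>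
    (hg i).comp_aemeasurable (hN.aemeasurable_coordVec i)
  refine integral_mono (Integrable.of_mem_Icc 0 1 (Finset.aemeasurable_fun_prod _ fun i _ => hgc i)
    (Filter.Eventually.of_forall fun ω => ⟨Finset.prod_nonneg fun i _ => (hgm i _).1,
      Finset.prod_le_one (fun i _ => (hgm i _).1) fun i _ => (hgm i _).2⟩))
    (Integrable.of_mem_Icc (-1) 1 (by
      exact (((((hfc 0).mul (hfc 1)).const_add 1).add ((hfc 1).mul (hfc 2))).add
        ((hfc 2).mul (hfc 0))).const_mul (1 / 4))
      (Filter.Eventually.of_forall fun ω => ?_)) fun ω => ?_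
  · have hp : ∀ x ∈ Set.Icc (-1 : ℝ) 1, ∀ y ∈ Set.Icc (-1 : ℝ) 1, x * y ∈ Set.Icc (-1 : ℝ) 1 := by
      intro x hx y hy
      refine abs_le.1 ?_
      rw [abs_mul]
      exact mul_le_one₀ (abs_le.2 hx) (abs_nonneg _) (abs_le.2 hy)
    have h1 := hp _ (hfm 0 (coordVec N 0 ω)) _ (hfm 1 (coordVec N 1 ω))
    have h2 := hp _ (hfm 1 (coordVec N 1 ω)) _ (hfm 2 (coordVec N 2 ω))
    have h3 := hp _ (hfm 2 (coordVec N 2 ω)) _ (hfm 0 (coordVec N 0 ω))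
    simp only [s]
    constructor <;> linarith [h1.1, h1.2, h2.1, h2.2, h3.1, h3.2]
  · dsimp only
    rw [Fin.prod_univ_three]
    exact prod_le_s hu (hfm 0 _) (hfm 1 _) (hfm 2 _)

/-- For `x, y = ±1` the indicator of `x = u, y = -u` is at least `(u x - u y) / 2`. -/
lemma half_diff_le_prob (hN : IsGaussianSample P C N) {f : Fin 3 → (Fin n → ℝ) → ℝ}
    (hf : ∀ i, Measurable (f i)) (hfm : ∀ i x, f i x ∈ ({-1, 1} : Set ℝ)) (i j : Fin 3) {u : ℝ}
    (hu : u ∈ ({-1, 1} : Set ℝ)) :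
    (u * ∫ ω, f i (coordVec N i ω) ∂P + -u * ∫ ω, f j (coordVec N j ω) ∂P) / 2 ≤
      P.real {ω | f i (coordVec N i ω) = u ∧ f j (coordVec N j ω) = -u} := by
  have hpm : ∀ i x, f i x = -1 ∨ f i x = 1 := fun i x => by simpa using hfm i x
  have hfI : ∀ i x, f i x ∈ Set.Icc (-1 : ℝ) 1 := fun i x => by
    rcases hfm i x with h | h <;> rw [h] <;> norm_num
  have hfc : ∀ i, AEMeasurable (fun ω => f i (coordVec N i ω)) P := fun i =>
    (hf i).comp_aemeasurable (hN.aemeasurable_coordVec i)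
  have hi : ∀ i, Integrable (fun ω => f i (coordVec N i ω)) P := fun i =>
    hN.integrable_comp i (hf i) (hfI i)
  have hS : NullMeasurableSet {ω | f i (coordVec N i ω) = u ∧ f j (coordVec N j ω) = -u} P :=
    (nullMeasurableSet_eq_fun (hfc i) aemeasurable_const).inter
      (nullMeasurableSet_eq_fun (hfc j) aemeasurable_const)
  rw [measureReal_eq_integral_indicator hS, ← integral_const_mul, ← integral_const_mul,
    ← integral_add ((hi i).const_mul u) ((hi j).const_mul (-u)), ← integral_div]
  refine integral_mono ((((hi i).const_mul u).add ((hi j).const_mul (-u))).div_const 2)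
    ((integrable_const (1 : ℝ)).indicator₀ hS) fun ω => ?_
  rw [Set.indicator_apply]
  rcases hu with rfl | rfl <;> rcases hpm i (coordVec N i ω) with h1 | h1 <;>
    rcases hpm j (coordVec N j ω) with h2 | h2 <;>
    simp only [h1, h2, Set.mem_ofPred_eq] <;> norm_num

end Paradox

lemma paradox_eq_prob {Ω : Type*} [MeasurableSpace Ω] {P : Measure Ω} {n : ℕ}
    {C : Fin 3 → Fin 3 → ℝ} {N : Fin n → Ω → Fin 3 → ℝ} (hN : IsGaussianSample P C N)
    {f : Fin 3 → (Fin n → ℝ) → ℝ} (hf : ∀ i, Measurable (f i))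
    (hfm : ∀ i x, f i x ∈ ({-1, 1} : Set ℝ)) :
    paradox P N f = P.real {ω | f 0 (coordVec N 0 ω) = f 1 (coordVec N 1 ω) ∧
      f 1 (coordVec N 1 ω) = f 2 (coordVec N 2 ω)} := by
  have hpm : ∀ i x, f i x = -1 ∨ f i x = 1 := fun i x => by simpa using hfm i x
  have hfc : ∀ i, AEMeasurable (fun ω => f i (coordVec N i ω)) P := fun i =>
    (hf i).comp_aemeasurable (hN.aemeasurable_coordVec i)
  have hS : NullMeasurableSet {ω | f 0 (coordVec N 0 ω) = f 1 (coordVec N 1 ω) ∧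
      f 1 (coordVec N 1 ω) = f 2 (coordVec N 2 ω)} P :=
    (nullMeasurableSet_eq_fun (hfc 0) (hfc 1)).inter (nullMeasurableSet_eq_fun (hfc 1) (hfc 2))
  rw [measureReal_eq_integral_indicator hS, paradox]
  congr 1
  ext ω
  rw [Set.indicator_apply]
  rcases hpm 0 (coordVec N 0 ω) with h1 | h1 <;>
    rcases hpm 1 (coordVec N 1 ω) with h2 | h2 <;>
    rcases hpm 2 (coordVec N 2 ω) with h3 | h3 <;>
    simp only [h1, h2, h3, Set.mem_ofPred_eq, s] <;> norm_num

end GaussArrow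

theorem theorem5p1 {Ω : Type*} [MeasurableSpace Ω] (P : Measure Ω) [IsProbabilityMeasure P]
    (n : ℕ) (N : Fin n → Ω → Fin 3 → ℝ) (ε : ℝ) (hε : 0 < ε)
    (f : Fin 3 → (Fin n → ℝ) → ℝ) (hf : ∀ i, Measurable (f i)) :
    -- Boolean functions, pairwise correlations `-1/3`
    (GaussArrow.IsGaussianSample P GaussArrow.uniformCov N →
      (∀ i x, f i x ∈ ({-1, 1} : Set ℝ)) →
      (∀ i : Fin 3, ∀ u ∈ ({-1, 1} : Set ℝ),
        P.real {ω | f i (GaussArrow.coordVec N i ω) = u ∧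
          f (i + 1) (GaussArrow.coordVec N (i + 1) ω) = -u} ≤ 1 - ε) →
      (ε / 2) ^ 18 ≤
        P.real {ω | f 0 (GaussArrow.coordVec N 0 ω) = f 1 (GaussArrow.coordVec N 1 ω) ∧
          f 1 (GaussArrow.coordVec N 1 ω) = f 2 (GaussArrow.coordVec N 2 ω)}) ∧
    -- `[-1,1]`-valued functions, pairwise correlations `-1/3`
    (GaussArrow.IsGaussianSample P GaussArrow.uniformCov N →
      (∀ i x, f i x ∈ Set.Icc (-1 : ℝ) 1) →
      (∀ i : Fin 3, ∀ u ∈ ({-1, 1} : Set ℝ),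
        min (u * ∫ ω, f i (GaussArrow.coordVec N i ω) ∂P)
          (-u * ∫ ω, f (i + 1) (GaussArrow.coordVec N (i + 1) ω) ∂P) ≤ 1 - 2 * ε) →
      (ε / 2) ^ 20 ≤ GaussArrow.paradox P N f) ∧
    -- `[-1,1]`-valued functions, correlations of a symmetric voting distribution
    (∀ μ : PMF (Equiv.Perm (Fin 3)), GaussArrow.IsSymmetric μ → 0 < GaussArrow.minAtom μ →
      GaussArrow.IsGaussianSample P (GaussArrow.voteCov μ) N →
      (∀ i x, f i x ∈ Set.Icc (-1 : ℝ) 1) →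
      (∀ i : Fin 3, ∀ u ∈ ({-1, 1} : Set ℝ),
        min (u * ∫ ω, f i (GaussArrow.coordVec N i ω) ∂P)
          (-u * ∫ ω, f (i + 1) (GaussArrow.coordVec N (i + 1) ω) ∂P) ≤ 1 - 2 * ε) →
      (ε / 2) ^ (2 + 1 / (2 * GaussArrow.minAtom μ ^ 2)) ≤ GaussArrow.paradox P N f) := by
  have usymm : ∀ i j, GaussArrow.uniformCov i j = GaussArrow.uniformCov j i := fun i j => by
    simp only [GaussArrow.uniformCov, eq_comm]
  have uself : ∀ i, GaussArrow.uniformCov i i = 1 := fun i => if_pos rfl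
  have hpow : ∀ k : ℕ, 9 ≤ k → ε ≤ 1 → (ε / 2) ^ k ≤ (ε / 2) ^ (3 / (1 / 3 : ℝ)) := by
    intro k hk hε1
    rw [show (3 / (1 / 3) : ℝ) = (9 : ℕ) by norm_num, Real.rpow_natCast]
    exact pow_le_pow_of_le_one (by linarith) (by linarith) hk
  -- Since `|E f| ≤ 1`, the hypothesis of the `[-1,1]`-valued versions forces `ε ≤ 1`.
  have heps : (∀ i x, f i x ∈ Set.Icc (-1 : ℝ) 1) →
      (∀ i : Fin 3, ∀ u ∈ ({-1, 1} : Set ℝ),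
        min (u * ∫ ω, f i (GaussArrow.coordVec N i ω) ∂P)
          (-u * ∫ ω, f (i + 1) (GaussArrow.coordVec N (i + 1) ω) ∂P) ≤ 1 - 2 * ε) → ε ≤ 1 := by
    intro hfm h
    have hm : ∀ i, |∫ ω, f i (GaussArrow.coordVec N i ω) ∂P| ≤ 1 := fun i => by
      have := norm_integral_le_of_norm_le_const (μ := P) (C := 1)
        (f := fun ω => f i (GaussArrow.coordVec N i ω))
        (Filter.Eventually.of_forall fun ω => abs_le.2 (hfm i _))
      simpa using this
    have h0 := abs_le.1 (hm 0)
    have h1 := abs_le.1 (hm (0 + 1))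
    rcases min_le_iff.1 (h 0 1 (by simp)) with h2 | h2 <;> linarith
  refine ⟨fun hN hfm h => ?_, fun hN hfm h => ?_, fun μ _ hα hN hfm h => ?_⟩
  · have hfI : ∀ i x, f i x ∈ Set.Icc (-1 : ℝ) 1 := fun i x => by
      rcases hfm i x with h | h <;> rw [h] <;> norm_num
    have hε1 : ε ≤ 1 := by
      have := measureReal_nonneg.trans (h 0 1 (by simp))
      linarith
    rw [← GaussArrow.paradox_eq_prob hN hf hfm]
    refine (hpow 18 (by norm_num) hε1).trans (GaussArrow.rpow_le_paradox (by norm_num) usymm uself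
      GaussArrow.uniformCov_coercive hN hε hε1 hf hfI fun i u hu => ?_)
    have h1 := (GaussArrow.half_diff_le_prob hN hf hfm i (i + 1) hu).trans (h i u hu)
    rw [min_le_iff]
    by_contra! hc
    linarith [hc.1, hc.2]
  · have hε1 := heps hfm h
    exact (hpow 20 (by norm_num) hε1).trans (GaussArrow.rpow_le_paradox (by norm_num) usymm uself
      GaussArrow.uniformCov_coercive hN hε hε1 hf hfm fun i u hu =>
        (h i u hu).trans (by linarith))
  · have hε1 := heps hfm h
    refine le_trans ?_ (GaussArrow.rpow_le_paradox (r := 2 * GaussArrow.minAtom μ) (by linarith)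
      (fun i j => by simp only [GaussArrow.voteCov, mul_comm]) (GaussArrow.voteCov_self μ)
      (GaussArrow.voteCov_coercive μ) hN hε hε1 hf hfm fun i u hu =>
        (h i u hu).trans (by linarith))
    refine Real.rpow_le_rpow_of_exponent_ge (by linarith) (by linarith) ?_
    -- With `t = 1 / α` this is `3 t / 2 ≤ 2 + t ^ 2 / 2`.
    have e : 2 + 1 / (2 * GaussArrow.minAtom μ ^ 2) - 3 / (2 * GaussArrow.minAtom μ) =
        ((1 / GaussArrow.minAtom μ - 3 / 2) ^ 2 + 7 / 4) / 2 := by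
      field_simp
      ring
    nlinarith [sq_nonneg (1 / GaussArrow.minAtom μ - 3 / 2)]
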